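/- Let $M>0$ and $Q,a\in\mathbb R$ be such that $\Delta(r)=r^2-2Mr+a^2+Q^2$ has at least one real zero (the non-extreme or the extreme Kerr–Newman case, $a^2+Q^2\le M^2$), and let $r_+$ be its largest zero. Let $x:(r_+,\infty)\to(-\infty,\infty)$ be the radial coordinate determined, up to an additive constant, by $$\frac{dx}{dr}=\frac{r^2+a^2}{\Delta(r)},$$ and write $r=r(x)$ for its inverse. Let $\Omega_2=(-\infty,\infty)\times(0,\pi)$ with coordinates $(x,\theta)$, let $\kappa\in\mathbb Z+\tfrac12$, and let $$\sigma_1=\begin{pmatrix}0&1\\1&0\end{pmatrix},\quad \sigma_2=\begin{pmatrix}0&-\mathrm i\\ \mathrm i&0\end{pmatrix},\quad \sigma_3=\begin{pmatrix}1&0\\0&-1\end{pmatrix}.$$ Then the minimal operator $h_{1,0}^{(\kappa)}$ in $L^2(\Omega_2)^2$ (Lebesgue measure $dx\,d\theta$, usual scalar product) with domain $C_0^\infty(\Omega_2)^2$, defined by $$h_{1,0}^{(\kappa)}\psi=\mathfrak h_1^{(\kappa)}\psi=-\sigma_3\,\mathrm i\,\frac{\partial\psi}{\partial x}-\frac{\sqrt{\Delta(r(x))}}{r(x)^2+a^2}\left(\sigma_1\,\mathrm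 i\,\frac{\partial\psi}{\partial\theta}+\sigma_2\,\frac{\kappa}{\sin\theta}\,\psi\right),$$ is essentially selfadjoint; that is, it is densely defined and symmetric, and its closure is selfadjoint. -/

import Mathlib

open MeasureTheory Set
open scoped Distributions

noncomputable section

namespace KerrNewman

/-! ### The metric functions and the radial coordinate -/

/-- The function `Δ(r) = r² - 2Mr + a² + Q²` of the Kerr-Newman metric with mass `M`, charge `Q`
and angular momentum parameter `a`. -/
def Delta (M Q a ρ : ℝ) : ℝ := ρ ^ 2 - 2 * M * ρ + a ^ 2 + Q ^ 2

/-- `x` is a new radial coordinate on `(r₊, ∞)` with values in `(-∞, ∞)` such that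
`dx/dr = (r² + a²) / Δ(r)`, and `r` is the old radial coordinate as a function of the new one,
that is, the inverse of `x : (r₊, ∞) → ℝ`.  The constant of integration is left free. -/
structure IsRadialCoordinate (M Q a rp : ℝ) (x r : ℝ → ℝ) : Prop where
  hasDerivAt : ∀ ρ, rp < ρ → HasDerivAt x ((ρ ^ 2 + a ^ 2) / Delta M Q a ρ) ρ
  left_inv : ∀ ρ, rp < ρ → r (x ρ) = ρ
  lt_apply : ∀ ξ, rp < r ξ
  right_inv : ∀ ξ, x (r ξ) = ξ

/-- The coefficient `√Δ / (r² + a²)` as a function of the new radial coordinate. -/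
def weight (M Q a : ℝ) (r : ℝ → ℝ) (ξ : ℝ) : ℝ :=
  Real.sqrt (Delta M Q a (r ξ)) / ((r ξ) ^ 2 + a ^ 2)

theorem horizon_pos {M Q a rp : ℝ} (hM : 0 < M)
    (hrp : IsGreatest {ρ | Delta M Q a ρ = 0} rp) : 0 < rp := by
  have h0 : Delta M Q a rp = 0 := hrp.1
  have h1 : 2 * M - rp ≤ rp := hrp.2 (by
    simp only [mem_ofPred_eq, Delta] at h0 ⊢
    linear_combination h0)
  linarith

theorem Delta_pos {M Q a rp : ℝ} (hrp : IsGreatest {ρ | Delta M Q a ρ = 0} rp) {ρ : ℝ}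
    (hρ : rp < ρ) : 0 < Delta M Q a ρ := by
  have h0 : Delta M Q a rp = 0 := hrp.1
  have h1 : 2 * M - rp ≤ rp := hrp.2 (by
    simp only [mem_ofPred_eq, Delta] at h0 ⊢
    linear_combination h0)
  have h2 : Delta M Q a ρ = (ρ - rp) * (ρ - (2 * M - rp)) := by
    simp only [Delta] at h0 ⊢
    linear_combination h0
  rw [h2]
  exact mul_pos (by linarith) (by linarith)

theorem IsRadialCoordinate.continuous {M Q a rp : ℝ} {x r : ℝ → ℝ} (hM : 0 < M)
    (hrp : IsGreatest {ρ | Delta M Q a ρ = 0} rp) (h : IsRadialCoordinate M Q a rp x r) :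
    Continuous r := by
  have hpos := horizon_pos hM hrp
  have hx : StrictMonoOn x (Ioi rp) := by
    refine strictMonoOn_of_deriv_pos (convex_Ioi rp)
      (fun ρ hρ => (h.hasDerivAt ρ hρ).continuousAt.continuousWithinAt) fun ρ hρ => ?_
    rw [interior_Ioi] at hρ
    have hρ' : rp < ρ := hρ
    rw [(h.hasDerivAt ρ hρ).deriv]
    have := Delta_pos hrp hρ'
    have : 0 < ρ := hpos.trans hρ'
    positivity
  have hr : StrictMono r := by
    intro s t hst
    by_contra hc
    have := hx.monotoneOn (h.lt_apply t) (h.lt_apply s) (not_lt.mp hc)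
    rw [h.right_inv, h.right_inv] at this
    exact absurd hst (not_lt.mpr this)
  let e : ℝ ≃o Ioi rp :=
    StrictMono.orderIsoOfSurjective (fun ξ => (⟨r ξ, h.lt_apply ξ⟩ : Ioi rp))
      (fun s t hst => hr hst) (fun ρ => ⟨x ρ, Subtype.ext (h.left_inv ρ ρ.2)⟩)
  exact continuous_subtype_val.comp e.continuous

theorem IsRadialCoordinate.continuous_weight {M Q a rp : ℝ} {x r : ℝ → ℝ}
    (h : IsRadialCoordinate M Q a rp x r) (hM : 0 < M)
    (hrp : IsGreatest {ρ | Delta M Q a ρ = 0} rp) : Continuous (weight M Q a r) := by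
  have hr := h.continuous hM hrp
  unfold weight Delta
  refine Continuous.div (by fun_prop) (by fun_prop) fun ξ => ?_
  have : 0 < r ξ := (horizon_pos hM hrp).trans (h.lt_apply ξ)
  positivity

/-! ### The Hilbert space and the test functions -/

/-- `ℂ²` with its usual scalar product. -/
abbrev Spinor : Type := EuclideanSpace ℂ (Fin 2)

/-- `Ω₂ = (-∞, ∞) × (0, π)`, with coordinates `(x, θ)`. -/
def Omega : TopologicalSpace.Opens (ℝ × ℝ) :=
  ⟨univ ×ˢ Ioo 0 Real.pi, isOpen_univ.prod isOpen_Ioo⟩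

/-- The Hilbert space `L²(Ω₂)²`, with respect to Lebesgue measure and the usual scalar product. -/
abbrev L2Omega : Type := Lp Spinor 2 (volume.restrict (Omega : Set (ℝ × ℝ)))

theorem memLp_of_tsupport {g : ℝ × ℝ → Spinor} (hg : ContinuousOn g (Omega : Set (ℝ × ℝ)))
    (hc : HasCompactSupport g) (hs : tsupport g ⊆ (Omega : Set (ℝ × ℝ))) :
    MemLp g 2 (volume.restrict (Omega : Set (ℝ × ℝ))) :=
  (hg.continuous_of_tsupport_subset Omega.isOpen hs).memLp_of_hasCompactSupport hc

theorem memLp_test (ψ : 𝓓(Omega, Spinor)) :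
    MemLp ψ 2 (volume.restrict (Omega : Set (ℝ × ℝ))) :=
  memLp_of_tsupport ψ.continuous.continuousOn ψ.hasCompactSupport ψ.tsupport_subset

/-- The inclusion of `C₀^∞(Ω₂)²` in `L²(Ω₂)²`. -/
def testToL2 : 𝓓(Omega, Spinor) →ₗ[ℂ] L2Omega where
  toFun ψ := (memLp_test ψ).toLp ψ
  map_add' _ _ := rfl
  map_smul' _ _ := rfl

theorem testToL2_injective : Function.Injective testToL2 := by
  intro ψ φ h
  have h1 : ψ =ᵐ[volume.restrict (Omega : Set (ℝ × ℝ))] φ :=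
    (MemLp.toLp_eq_toLp_iff (memLp_test ψ) (memLp_test φ)).mp h
  have h2 : EqOn ψ φ (Omega : Set (ℝ × ℝ)) :=
    Measure.eqOn_open_of_ae_eq h1 Omega.isOpen ψ.continuous.continuousOn φ.continuous.continuousOn
  ext1 p
  by_cases hp : p ∈ (Omega : Set (ℝ × ℝ))
  · exact h2 hp
  · rw [image_eq_zero_of_notMem_tsupport fun hq => hp (ψ.tsupport_subset hq),
      image_eq_zero_of_notMem_tsupport fun hq => hp (φ.tsupport_subset hq)]

/-! ### The differential expression and its minimal operator -/

/-- The Pauli matrix `σ₁`. -/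
def pauli1 : Matrix (Fin 2) (Fin 2) ℂ := !![0, 1; 1, 0]

/-- The Pauli matrix `σ₂`. -/
def pauli2 : Matrix (Fin 2) (Fin 2) ℂ := !![0, -Complex.I; Complex.I, 0]

/-- The Pauli matrix `σ₃`. -/
def pauli3 : Matrix (Fin 2) (Fin 2) ℂ := !![1, 0; 0, -1]

/-- The differential expression
`-σ₃ i ∂ψ/∂x - w(x) (σ₁ i ∂ψ/∂θ + σ₂ (κ / sin θ) ψ)` at the point `p = (x, θ)`. -/
def diracExpr (w : ℝ → ℝ) (κ : ℝ) (ψ : ℝ × ℝ → Spinor) (p : ℝ × ℝ) : Spinor :=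
  -Matrix.toEuclideanCLM (𝕜 := ℂ) pauli3 (Complex.I • fderiv ℝ ψ p (1, 0))
    - (w p.1 : ℂ) •
      (Matrix.toEuclideanCLM (𝕜 := ℂ) pauli1 (Complex.I • fderiv ℝ ψ p (0, 1))
        + ((κ / Real.sin p.2 : ℝ) : ℂ) • Matrix.toEuclideanCLM (𝕜 := ℂ) pauli2 (ψ p))

theorem support_diracExpr_subset (w : ℝ → ℝ) (κ : ℝ) (ψ : ℝ × ℝ → Spinor) :
    Function.support (diracExpr w κ ψ) ⊆ tsupport ψ := by
  intro p hp
  by_contra hq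
  have h1 : fderiv ℝ ψ p = 0 := by
    by_contra hd
    exact hq (support_fderiv_subset ℝ hd)
  exact hp (by simp [diracExpr, h1, image_eq_zero_of_notMem_tsupport hq])

theorem memLp_diracExpr {w : ℝ → ℝ} (hw : Continuous w) (κ : ℝ) (ψ : 𝓓(Omega, Spinor)) :
    MemLp (diracExpr w κ ψ) 2 (volume.restrict (Omega : Set (ℝ × ℝ))) := by
  have hsupp : tsupport (diracExpr w κ ψ) ⊆ tsupport ψ :=
    closure_minimal (support_diracExpr_subset w κ ψ) (isClosed_tsupport _)
  have hd : Continuous (fderiv ℝ ψ) := ψ.contDiff.continuous_fderiv (by simp)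
  have hψ : Continuous ψ := ψ.continuous
  have hsin : ContinuousOn (fun p : ℝ × ℝ => ((κ / Real.sin p.2 : ℝ) : ℂ))
      (Omega : Set (ℝ × ℝ)) := by
    refine Complex.continuous_ofReal.comp_continuousOn ?_
    refine ContinuousOn.div (by fun_prop) (by fun_prop) fun p hp => ?_
    exact (Real.sin_pos_of_pos_of_lt_pi hp.2.1 hp.2.2).ne'
  refine memLp_of_tsupport ?_ (ψ.hasCompactSupport.mono' (support_diracExpr_subset w κ ψ))
    (hsupp.trans ψ.tsupport_subset)
  have h1 : Continuous fun p : ℝ × ℝ =>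
      Matrix.toEuclideanCLM (𝕜 := ℂ) pauli3 (Complex.I • fderiv ℝ ψ p (1, 0)) := by fun_prop
  have h2 : Continuous fun p : ℝ × ℝ =>
      Matrix.toEuclideanCLM (𝕜 := ℂ) pauli1 (Complex.I • fderiv ℝ ψ p (0, 1)) := by fun_prop
  have h3 : Continuous fun p : ℝ × ℝ => Matrix.toEuclideanCLM (𝕜 := ℂ) pauli2 (ψ p) := by fun_prop
  have h4 : Continuous fun p : ℝ × ℝ => (w p.1 : ℂ) := by fun_prop
  exact h1.neg.continuousOn.sub
    (h4.continuousOn.smul (h2.continuousOn.add (hsin.smul h3.continuousOn)))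

theorem diracExpr_add (w : ℝ → ℝ) (κ : ℝ) (ψ φ : 𝓓(Omega, Spinor)) :
    diracExpr w κ ⇑(ψ + φ) = diracExpr w κ ψ + diracExpr w κ φ := by
  funext p
  have hψ : DifferentiableAt ℝ ψ p := (ψ.contDiff.differentiable (by simp)) p
  have hφ : DifferentiableAt ℝ φ p := (φ.contDiff.differentiable (by simp)) p
  have h : fderiv ℝ ⇑(ψ + φ) p = fderiv ℝ ψ p + fderiv ℝ φ p := fderiv_add hψ hφ
  have h' : (ψ + φ) p = ψ p + φ p := rfl
  simp only [diracExpr, h, h', Pi.add_apply, add_apply, smul_add, map_add]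
  abel

theorem diracExpr_smul (w : ℝ → ℝ) (κ : ℝ) (c : ℂ) (ψ : 𝓓(Omega, Spinor)) :
    diracExpr w κ ⇑(c • ψ) = c • diracExpr w κ ψ := by
  funext p
  have hψ : DifferentiableAt ℝ ψ p := (ψ.contDiff.differentiable (by simp)) p
  have h : fderiv ℝ ⇑(c • ψ) p = c • fderiv ℝ ψ p := fderiv_const_smul hψ c
  have h' : (c • ψ) p = c • ψ p := rfl
  simp only [diracExpr, h, h', Pi.smul_apply, smul_apply, map_smul, smul_add, smul_sub, smul_neg,
    smul_smul, mul_comm, mul_left_comm]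

/-- The differential expression as a linear map from `C₀^∞(Ω₂)²` to `L²(Ω₂)²`. -/
def diracOnTest (w : ℝ → ℝ) (hw : Continuous w) (κ : ℝ) : 𝓓(Omega, Spinor) →ₗ[ℂ] L2Omega where
  toFun ψ := (memLp_diracExpr hw κ ψ).toLp (diracExpr w κ ψ)
  map_add' ψ φ := by
    rw [← MemLp.toLp_add]
    exact MemLp.toLp_congr _ _ (by rw [diracExpr_add])
  map_smul' c ψ := by
    rw [RingHom.id_apply, ← MemLp.toLp_const_smul]
    exact MemLp.toLp_congr _ _ (by rw [diracExpr_smul])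

/-- The minimal operator: the unbounded operator in `L²(Ω₂)²` with domain `C₀^∞(Ω₂)²` that acts by
the differential expression `diracExpr w κ`. -/
def minimalOperator (w : ℝ → ℝ) (hw : Continuous w) (κ : ℝ) : L2Omega →ₗ.[ℂ] L2Omega where
  domain := LinearMap.range testToL2
  toFun := diracOnTest w hw κ ∘ₗ
    (LinearEquiv.ofInjective testToL2 testToL2_injective).symm.toLinearMap

theorem minimalOperator_apply (w : ℝ → ℝ) (hw : Continuous w) (κ : ℝ) (ψ : 𝓓(Omega, Spinor)) :
    minimalOperator w hw κ ⟨testToL2 ψ, LinearMap.mem_range_self _ ψ⟩ = diracOnTest w hw κ ψ :=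
  congrArg (diracOnTest w hw κ)
    ((LinearEquiv.ofInjective testToL2 testToL2_injective).symm_apply_apply ψ)

/-- An unbounded operator is essentially selfadjoint if it is densely defined and symmetric (hence
closable) and its closure is selfadjoint. -/
structure IsEssentiallySelfAdjoint {E : Type*} [NormedAddCommGroup E] [InnerProductSpace ℂ E]
    [CompleteSpace E] (T : E →ₗ.[ℂ] E) : Prop where
  dense_domain : Dense (T.domain : Set E)
  symmetric : T.IsFormalAdjoint T
  isClosable : T.IsClosable
  isSelfAdjoint_closure : IsSelfAdjoint T.closure

end KerrNewman

end

/-! By von Neumann's criterion it suffices that the ranges of `T + i` and `T - i` have trivial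
orthogonal complements, i.e. that a square integrable weak solution `v` of the deficiency equation
vanishes. No property of the weight is needed beyond continuity; no property of `κ` beyond `|κ| ≥
1/2`.

The variables are separated without any spectral theory of the angular operator. The functions
`angularSin ν n` and `angularCos ν n`, with `ν = |κ|`, are mapped into each other by `∂_θ ± ν / sin
θ` up to terms of index `n - 1` (`hasDerivAt_angularSin`, `hasDerivAt_angularCos`). Testing with
`f(x)` times such a function and inducting on `n`, the moments `U`, `V` of the two components of `v`
solve weakly `U' = ω V - s U`, `V' = ω U + s V` with `s ≠ 0`. For such a system `(U² - V²)' = -2s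
(U² + V²)`; as `U` and `V` are in `L²`, integration over the line forces `U = V = 0`, however large
`ω` may be (`ae_eq_zero_of_weak_system`). Once all moments vanish, Weierstrass approximation in `cos
θ` gives `v = 0` (`ae_eq_zero_of_angularMoment`).

The delicate point is that the angular functions do not have compact support in `(0, π)`. They are
`O(√(sin θ))` exactly because `ν ≥ 1/2`, and this is just enough for the error made by a cutoff at
the poles to be bounded in `L²`; since it lives on shrinking strips, it tends weakly to zero
(`IsWeakSolution.integral_fst_mul`). -/

noncomputable section

namespace KerrNewman

/-! ### A criterion for essential selfadjointness -/

section Criterion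

variable {E : Type*} [NormedAddCommGroup E] [InnerProductSpace ℂ E]

/-- Symmetry makes `⟨v, T v⟩` real, so the imaginary part of `⟨v, (T + i) v⟩` is exactly `‖v‖²`;
Cauchy–Schwarz does the rest. -/
theorem norm_le_norm_apply_add_smul {T : E →ₗ.[ℂ] E} (hT : T.IsFormalAdjoint T)
    (v : T.domain) : ‖(v : E)‖ ≤ ‖T v + Complex.I • (v : E)‖ := by
  have h1 : inner ℂ (v : E) (T v + Complex.I • (v : E))
      = inner ℂ (v : E) (T v) + Complex.I * (‖(v : E)‖ ^ 2 : ℝ) := by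
    rw [inner_add_right, inner_smul_right, inner_self_eq_norm_sq_to_K]; simp
  have h2 : (inner ℂ (v : E) (T v) : ℂ).im = 0 := by
    have h3 := hT v v
    rw [← inner_conj_symm] at h3
    exact Complex.conj_eq_iff_im.mp h3
  have h4 : (inner ℂ (v : E) (T v + Complex.I • (v : E))).im = ‖(v : E)‖ ^ 2 := by
    rw [h1, Complex.add_im, h2]; simp [-Complex.ofReal_pow]
  have h5 : ‖(v : E)‖ ^ 2 ≤ ‖(v : E)‖ * ‖T v + Complex.I • (v : E)‖ := by
    rw [← h4]
    exact (le_abs_self _).trans ((Complex.abs_im_le_norm _).trans (norm_inner_le_norm _ _))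
  by_cases h0 : ‖(v : E)‖ = 0
  · rw [h0]; positivity
  · have : 0 < ‖(v : E)‖ := lt_of_le_of_ne (norm_nonneg _) (Ne.symm h0)
    nlinarith

variable [CompleteSpace E]

/-- Surjectivity of "closure of `T`, plus `i`": the range of `T + i` is dense, and since `T + i` is
bounded below, preimages of a convergent sequence are Cauchy. -/
theorem exists_mem_closure_graph {T : E →ₗ.[ℂ] E} (hT : T.IsFormalAdjoint T)
    (h : ∀ v : E, (∀ u : T.domain, inner ℂ (T u + Complex.I • (u : E)) v = 0) → v = 0) (w : E) :
    ∃ y : E, (y, w - Complex.I • y) ∈ T.graph.topologicalClosure := by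
  let S : T.domain →ₗ[ℂ] E := T.toFun + Complex.I • T.domain.subtype
  have hdense : (LinearMap.range S).topologicalClosure = ⊤ := by
    rw [Submodule.topologicalClosure_eq_top_iff, Submodule.eq_bot_iff]
    intro v hv
    refine h v fun u => ?_
    exact (Submodule.mem_orthogonal _ _).mp hv _ ⟨u, rfl⟩
  have hw : w ∈ closure (LinearMap.range S : Set E) := by
    rw [← Submodule.topologicalClosure_coe, hdense]; trivial
  obtain ⟨s, hs, hlim⟩ := mem_closure_iff_seq_limit.mp hw
  choose t ht using hs
  have hcau : CauchySeq fun n => (t n : E) := by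
    refine Metric.cauchySeq_iff'.mpr fun ε hε => ?_
    obtain ⟨N, hN⟩ := Metric.cauchySeq_iff'.mp hlim.cauchySeq ε hε
    refine ⟨N, fun n hn => lt_of_le_of_lt ?_ (hN n hn)⟩
    rw [dist_eq_norm, dist_eq_norm, ← ht, ← ht, ← map_sub]
    exact norm_le_norm_apply_add_smul hT (t n - t N)
  obtain ⟨y, hy⟩ := cauchySeq_tendsto_of_complete hcau
  refine ⟨y, ?_⟩
  have h2 : Filter.Tendsto (fun n => ((t n : E), T (t n))) Filter.atTop
      (nhds (y, w - Complex.I • y)) := by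
    refine hy.prodMk_nhds ?_
    have := hlim.sub (hy.const_smul Complex.I)
    refine this.congr fun n => ?_
    rw [← ht]
    exact add_sub_cancel_right _ _
  exact mem_closure_of_tendsto h2 (Filter.Eventually.of_forall fun n => T.mem_graph (t n))

/-- A densely defined symmetric operator `T` is essentially selfadjoint as soon as the ranges of
`T + i` and `T - i` have trivial orthogonal complements. -/
theorem IsEssentiallySelfAdjoint.of_orthogonal_range {T : E →ₗ.[ℂ] E}
    (hd : Dense (T.domain : Set E)) (hT : T.IsFormalAdjoint T)
    (h1 : ∀ v : E, (∀ u : T.domain, inner ℂ (T u + Complex.I • (u : E)) v = 0) → v = 0)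
    (h2 : ∀ v : E, (∀ u : T.domain, inner ℂ (T u - Complex.I • (u : E)) v = 0) → v = 0) :
    IsEssentiallySelfAdjoint T := by
  have hle : T ≤ T.adjoint := hT.le_adjoint hd
  have hclosed := T.adjoint_isClosed hd
  have hclos : T.IsClosable := hclosed.isClosable.leIsClosable hle
  have hcle : T.closure ≤ T.adjoint := by
    refine LinearPMap.le_of_le_graph ?_
    rw [← hclos.graph_closure_eq_closure_graph]
    exact Submodule.topologicalClosure_minimal _ (LinearPMap.le_graph_of_le hle) hclosed
  have hdc : Dense (T.closure.domain : Set E) := hd.mono T.le_closure.1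
  -- For `(v, z)` in the graph of `T*`, solve `(closure of T + i) y = z + i v`. Then `T* (v - y) =
  -- -i (v - y)`, so `v - y` is orthogonal to the range of `T - i` and vanishes by `h2`.
  have key : T.adjoint ≤ T.closure := by
    refine LinearPMap.le_of_le_graph ?_
    rintro ⟨v, z⟩ hvz
    obtain ⟨y, hy⟩ := exists_mem_closure_graph hT h1 (z + Complex.I • v)
    rw [hclos.graph_closure_eq_closure_graph] at hy
    have hy' := LinearPMap.le_graph_of_le hcle hy
    have hsub := T.adjoint.graph.sub_mem hvz hy'
    obtain ⟨d, hd1, hd2⟩ := (LinearPMap.mem_graph_iff _).mp hsub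
    have hvy : v - y = 0 := by
      refine h2 _ fun u => ?_
      have h3 := LinearPMap.adjoint_isFormalAdjoint hd d u
      simp only [Prod.fst_sub, Prod.snd_sub] at hd1 hd2
      have h5 : z - (z + Complex.I • v - Complex.I • y) = - Complex.I • (v - y) := by
        rw [neg_smul, smul_sub]; abel
      rw [hd1, hd2, h5, inner_smul_left] at h3
      rw [← inner_conj_symm, inner_sub_right, inner_smul_right, ← h3]
      simp
    rw [sub_eq_zero] at hvy
    subst hvy
    simpa using hy
  have heq : T.closure = T.adjoint := le_antisymm hcle key
  refine ⟨hd, hT, hclos, ?_⟩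
  rw [LinearPMap.isSelfAdjoint_def]
  refine le_antisymm ?_ ?_
  · refine le_trans (LinearPMap.IsFormalAdjoint.le_adjoint hd ?_) heq.symm.le
    intro u v
    have hv : (u : E) ∈ T.closure.domain := T.le_closure.1 u.2
    have h3 := LinearPMap.adjoint_isFormalAdjoint hdc v ⟨u, hv⟩
    have h4 : T u = T.closure ⟨u, hv⟩ := T.le_closure.2 rfl
    rw [h4, ← inner_conj_symm, ← h3, inner_conj_symm]
  · refine LinearPMap.IsFormalAdjoint.le_adjoint hdc ?_
    intro u v
    have hfa : T.adjoint.IsFormalAdjoint T.closure := by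
      intro a b
      have hab : ((b : E), T.closure b) ∈ T.graph.topologicalClosure := by
        rw [hclos.graph_closure_eq_closure_graph]; exact T.closure.mem_graph b
      -- For fixed `a`, the relation `⟨T* a, p⟩ = ⟨a, q⟩` is a closed linear condition on `(p, q)`,
      -- hence passes from the graph of `T` to its closure.
      have hset : T.graph.topologicalClosure ≤
          (LinearMap.ker ((innerₛₗ ℂ (T.adjoint a)) ∘ₗ LinearMap.fst ℂ E E
            - (innerₛₗ ℂ (a : E)) ∘ₗ LinearMap.snd ℂ E E)) := by
        refine Submodule.topologicalClosure_minimal _ ?_ ?_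
        · rintro ⟨p, q⟩ hpq
          obtain ⟨d, hd1, hd2⟩ := (LinearPMap.mem_graph_iff _).mp hpq
          simp only at hd1 hd2
          have := LinearPMap.adjoint_isFormalAdjoint hd a d
          rw [hd1, hd2] at this
          simp [LinearMap.mem_ker, this]
        · have : Continuous fun p : E × E => inner ℂ (T.adjoint a) p.1 - inner ℂ (a : E) p.2 := by
            fun_prop
          exact isClosed_singleton.preimage this
      have := hset hab
      simpa [LinearMap.mem_ker, sub_eq_zero] using this
    have hu : (u : E) ∈ T.adjoint.domain := hcle.1 u.2
    have h4 : T.closure u = T.adjoint ⟨u, hu⟩ := hcle.2 rfl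
    rw [h4]
    exact hfa ⟨u, hu⟩ v

end Criterion

/-! ### Weak derivatives on the real line -/

theorem exists_pos_support_subset_Ioo {E : Type*} [Zero E] {f : ℝ → E}
    (hf : HasCompactSupport f) : ∃ R : ℝ, 0 < R ∧ Function.support f ⊆ Ioo (-R) R := by
  obtain ⟨R, hR⟩ := hf.isCompact.isBounded.subset_ball (0 : ℝ)
  refine ⟨max R 1, by positivity, fun x hx => ?_⟩
  have := hR (subset_tsupport f hx)
  rw [Metric.mem_ball, dist_zero_right, Real.norm_eq_abs] at this
  exact abs_lt.mp (this.trans_le (le_max_left _ _))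

/-- Integration by parts for a primitive that is only absolutely continuous, with derivative `K`
almost everywhere by Lebesgue differentiation. -/
theorem integral_deriv_mul_primitive {K f : ℝ → ℝ} (hK : LocallyIntegrable K)
    (hf : ContDiff ℝ 1 f) (hc : HasCompactSupport f) :
    ∫ x, deriv f x * ∫ t in (0 : ℝ)..x, K t = -∫ x, f x * K x := by
  obtain ⟨R, hR, hs⟩ := exists_pos_support_subset_Ioo hc
  obtain ⟨R', hR', hs'⟩ := exists_pos_support_subset_Ioo hc.deriv
  set S := max R R' with hS
  have hsub : Ioo (-R) R ⊆ Ioc (-S) S := fun x hx =>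
    ⟨by linarith [hx.1, le_max_left R R'], by linarith [hx.2, le_max_left R R']⟩
  have hsub' : Ioo (-R') R' ⊆ Ioc (-S) S := fun x hx =>
    ⟨by linarith [hx.1, le_max_right R R'], by linarith [hx.2, le_max_right R R']⟩
  have hSpos : 0 < S := lt_max_of_lt_left hR
  have e1 : ∫ x in (-S)..S, deriv f x * ∫ t in (0 : ℝ)..x, K t
      = ∫ x, deriv f x * ∫ t in (0 : ℝ)..x, K t :=
    intervalIntegral.integral_eq_integral_of_support_subset
      ((Function.support_mul_subset_left _ _).trans (hs'.trans hsub'))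
  have e2 : ∫ x in (-S)..S, f x * K x = ∫ x, f x * K x :=
    intervalIntegral.integral_eq_integral_of_support_subset
      ((Function.support_mul_subset_left _ _).trans (hs.trans hsub))
  have hKi : IntervalIntegrable K volume (-S) S :=
    (hK.integrableOn_isCompact isCompact_uIcc).intervalIntegrable
  have hac : AbsolutelyContinuousOnInterval (fun x => ∫ t in (0 : ℝ)..x, K t) (-S) S :=
    hKi.absolutelyContinuousOnInterval_intervalIntegral (c := 0)
      (by rw [uIcc_of_le (by linarith)]; constructor <;> linarith)
  have hfac : AbsolutelyContinuousOnInterval f (-S) S := hf.contDiffOn.absolutelyContinuousOnInterval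
  have h := hfac.integral_mul_deriv_eq_deriv_mul hac
  have hz1 : f S = 0 := by
    by_contra h0
    linarith [(hs (a := S) h0).2, le_max_left R R']
  have hz2 : f (-S) = 0 := by
    by_contra h0
    linarith [(hs (a := -S) h0).1, le_max_left R R']
  rw [hz1, hz2] at h
  have e3 : ∫ x in (-S)..S, f x * deriv (fun x => ∫ t in (0 : ℝ)..x, K t) x
      = ∫ x in (-S)..S, f x * K x := by
    refine intervalIntegral.integral_congr_ae ?_
    filter_upwards [LocallyIntegrable.ae_hasDerivAt_integral hK] with x hx _
    rw [(hx 0).deriv]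
  rw [← e1, ← e2]
  linarith

/-- The du Bois-Reymond lemma. With a bump `φ` of integral `1` and `m = ∫ g`, the function `g - m φ`
has integral zero, so its primitive is again a test function; hence `∫ g W = m ∫ φ W`, and the
constant is `∫ φ W`. -/
theorem ae_eq_const_of_integral_deriv_mul_eq_zero {W : ℝ → ℝ} (hW : LocallyIntegrable W)
    (h : ∀ f : ℝ → ℝ, ContDiff ℝ (⊤ : ℕ∞) f → HasCompactSupport f → ∫ x, deriv f x * W x = 0) :
    ∃ c : ℝ, ∀ᵐ x, W x = c := by
  let b : ContDiffBump (0 : ℝ) := ⟨1, 2, one_pos, one_lt_two⟩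
  let φ : ℝ → ℝ := b.normed volume
  have hφ : ContDiff ℝ (⊤ : ℕ∞) φ := b.contDiff_normed
  have hφc : HasCompactSupport φ := b.hasCompactSupport_normed
  have hφ1 : ∫ x, φ x = 1 := b.integral_normed
  have hint : ∀ g : ℝ → ℝ, ContDiff ℝ (⊤ : ℕ∞) g → HasCompactSupport g →
      Integrable fun x => g x * W x := fun g hg hgc =>
    hW.integrable_smul_left_of_hasCompactSupport hg.continuous hgc
  refine ⟨∫ x, φ x * W x, ?_⟩
  refine ae_eq_of_integral_contDiff_smul_eq hW (locallyIntegrable_const _) fun g hg hgc => ?_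
  set m := ∫ x, g x with hm
  have hhd : ContDiff ℝ (⊤ : ℕ∞) fun x => g x - m * φ x := hg.sub (contDiff_const.mul hφ)
  have hhc : HasCompactSupport fun x => g x - m * φ x := hgc.sub hφc.mul_left
  obtain ⟨R, hR, hs⟩ := exists_pos_support_subset_Ioo hhc
  have hh0 : ∫ x, (g x - m * φ x) = 0 := by
    rw [integral_sub (hg.continuous.integrable_of_hasCompactSupport hgc)
      ((hφ.continuous.integrable_of_hasCompactSupport hφc).const_mul m), integral_const_mul, hφ1]
    simp [hm]
  let F : ℝ → ℝ := fun x => ∫ t in (-R)..x, (g t - m * φ t)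
  have hF : ∀ x, HasDerivAt F (g x - m * φ x) x := fun x =>
    intervalIntegral.integral_hasDerivAt_right (hhd.continuous.intervalIntegrable _ _)
      (hhd.continuous.stronglyMeasurableAtFilter _ _) hhd.continuous.continuousAt
  have hFd : deriv F = fun x => g x - m * φ x := funext fun x => (hF x).deriv
  have hFs : ContDiff ℝ (⊤ : ℕ∞) F := by
    rw [contDiff_infty_iff_deriv, hFd]
    exact ⟨fun x => (hF x).differentiableAt, hhd⟩
  have hFc : HasCompactSupport F := by
    refine HasCompactSupport.intro (isCompact_Icc (a := -R) (b := R)) fun x hx => ?_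
    rcases lt_or_ge x (-R) with hx1 | hx1
    · refine (intervalIntegral.integral_congr (g := fun _ => (0 : ℝ)) fun t ht => ?_).trans
        (by simp)
      by_contra h0
      rw [uIcc_of_ge hx1.le] at ht
      linarith [(hs (a := t) h0).1, ht.2]
    · have hx2 : R < x := by
        by_contra h0
        exact hx ⟨hx1, not_lt.mp h0⟩
      change ∫ t in (-R)..x, (g t - m * φ t) = 0
      rw [intervalIntegral.integral_eq_integral_of_support_subset (hs.trans fun t ht =>
        ⟨ht.1, ht.2.le.trans hx2.le⟩), hh0]
  have h1 := h F hFs hFc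
  rw [hFd] at h1
  have h2 : ∫ x, (g x * W x - m * (φ x * W x)) = 0 := by
    rw [← h1]; congr 1; funext x; ring
  rw [integral_sub (hint g hg hgc) ((hint φ hφ hφc).const_mul m), integral_const_mul] at h2
  simp only [smul_eq_mul]
  rw [integral_mul_const, ← hm]
  linarith

/-- A function with a locally integrable weak derivative `K` is a primitive of `K`. -/
theorem ae_eq_const_add_primitive {U K : ℝ → ℝ} (hU : LocallyIntegrable U)
    (hK : LocallyIntegrable K)
    (h : ∀ f : ℝ → ℝ, ContDiff ℝ (⊤ : ℕ∞) f → HasCompactSupport f →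
      ∫ x, (deriv f x * U x + f x * K x) = 0) :
    ∃ c : ℝ, ∀ᵐ x, U x = c + ∫ t in (0 : ℝ)..x, K t := by
  have hP : Continuous fun x => ∫ t in (0 : ℝ)..x, K t :=
    intervalIntegral.continuous_primitive (fun _ _ =>
      (hK.integrableOn_isCompact isCompact_uIcc).intervalIntegrable) 0
  obtain ⟨c, hc⟩ := ae_eq_const_of_integral_deriv_mul_eq_zero
    (W := fun x => U x - ∫ t in (0 : ℝ)..x, K t) (hU.sub hP.locallyIntegrable) (by
      intro f hf hfc
      have hf' : Continuous (deriv f) := hf.continuous_deriv (by simp)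
      have i1 : Integrable fun x => deriv f x * U x :=
        hU.integrable_smul_left_of_hasCompactSupport hf' hfc.deriv
      have i2 : Integrable fun x => deriv f x * ∫ t in (0 : ℝ)..x, K t :=
        hP.locallyIntegrable.integrable_smul_left_of_hasCompactSupport hf' hfc.deriv
      have i3 : Integrable fun x => f x * K x :=
        hK.integrable_smul_left_of_hasCompactSupport hf.continuous hfc
      have h1 := h f hf hfc
      rw [integral_add i1 i3] at h1
      simp only [mul_sub]
      rw [integral_sub i1 i2, integral_deriv_mul_primitive hK (hf.of_le (by simp)) hfc]
      linarith)
  exact ⟨c, hc.mono fun x hx => by linarith⟩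

/-- A square integrable weak solution of the first order system `U' = ω V - s U`,
`V' = ω U + s V` with `s ≠ 0` vanishes. -/
theorem ae_eq_zero_of_weak_system {ω U V : ℝ → ℝ} {s : ℝ} (hω : Continuous ω) (hs : s ≠ 0)
    (hU : MemLp U 2) (hV : MemLp V 2)
    (h1 : ∀ f : ℝ → ℝ, ContDiff ℝ (⊤ : ℕ∞) f → HasCompactSupport f →
      ∫ x, (deriv f x * U x + f x * (ω x * V x - s * U x)) = 0)
    (h2 : ∀ f : ℝ → ℝ, ContDiff ℝ (⊤ : ℕ∞) f → HasCompactSupport f →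
      ∫ x, (deriv f x * V x + f x * (ω x * U x + s * V x)) = 0) :
    (∀ᵐ x, U x = 0) ∧ ∀ᵐ x, V x = 0 := by
  have lU : LocallyIntegrable U := hU.locallyIntegrable (by norm_num)
  have lV : LocallyIntegrable V := hV.locallyIntegrable (by norm_num)
  have lωU : LocallyIntegrable fun x => ω x * U x := by
    rw [← locallyIntegrableOn_univ] at lU ⊢
    exact lU.continuousOn_mul hω.continuousOn isOpen_univ.isLocallyClosed
  have lωV : LocallyIntegrable fun x => ω x * V x := by
    rw [← locallyIntegrableOn_univ] at lV ⊢
    exact lV.continuousOn_mul hω.continuousOn isOpen_univ.isLocallyClosed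
  have lK1 : LocallyIntegrable fun x => ω x * V x - s * U x := lωV.sub (lU.smul s)
  have lK2 : LocallyIntegrable fun x => ω x * U x + s * V x := lωU.add (lV.smul s)
  obtain ⟨c, hc⟩ := ae_eq_const_add_primitive lU lK1 h1
  obtain ⟨d, hd⟩ := ae_eq_const_add_primitive lV lK2 h2
  set A : ℝ → ℝ := fun x => c + ∫ t in (0 : ℝ)..x, (ω t * V t - s * U t) with hA
  set B : ℝ → ℝ := fun x => d + ∫ t in (0 : ℝ)..x, (ω t * U t + s * V t) with hB
  have cA : Continuous A :=
    continuous_const.add (intervalIntegral.continuous_primitive (fun _ _ =>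
      (lK1.integrableOn_isCompact isCompact_uIcc).intervalIntegrable) 0)
  have cB : Continuous B :=
    continuous_const.add (intervalIntegral.continuous_primitive (fun _ _ =>
      (lK2.integrableOn_isCompact isCompact_uIcc).intervalIntegrable) 0)
  -- Under the integral, `U` and `V` may be replaced by their continuous representatives `A` and
  -- `B`; the integrands become continuous and `(A, B)` is a classical solution.
  have dA : ∀ x, HasDerivAt A (ω x * B x - s * A x) x := by
    have e : A = fun x => c + ∫ t in (0 : ℝ)..x, (ω t * B t - s * A t) := by
      funext x
      rw [hA]
      refine congrArg (c + ·) (intervalIntegral.integral_congr_ae ?_)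
      filter_upwards [hc, hd] with t h3 h4 _
      rw [h3, h4]
    intro x
    have hcont : Continuous fun t => ω t * B t - s * A t := by fun_prop
    have := (intervalIntegral.integral_hasDerivAt_right (hcont.intervalIntegrable 0 x)
      (hcont.stronglyMeasurableAtFilter _ _) hcont.continuousAt).const_add c
    rw [← e] at this
    exact this
  have dB : ∀ x, HasDerivAt B (ω x * A x + s * B x) x := by
    have e : B = fun x => d + ∫ t in (0 : ℝ)..x, (ω t * A t + s * B t) := by
      funext x
      rw [hB]
      refine congrArg (d + ·) (intervalIntegral.integral_congr_ae ?_)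
      filter_upwards [hc, hd] with t h3 h4 _
      rw [h3, h4]
    intro x
    have hcont : Continuous fun t => ω t * A t + s * B t := by fun_prop
    have := (intervalIntegral.integral_hasDerivAt_right (hcont.intervalIntegrable 0 x)
      (hcont.stronglyMeasurableAtFilter _ _) hcont.continuousAt).const_add d
    rw [← e] at this
    exact this
  have iA : Integrable fun x => A x ^ 2 := (hU.integrable_sq).congr (by
    filter_upwards [hc] with x hx
    rw [hx])
  have iB : Integrable fun x => B x ^ 2 := (hV.integrable_sq).congr (by
    filter_upwards [hd] with x hx
    rw [hx])
  -- The terms with `ω` cancel in the difference of squares, so no bound on `ω` is needed. Both this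
  -- difference and its derivative are integrable, so the derivative has integral zero.
  have hQ : ∀ x, HasDerivAt (fun x => A x ^ 2 - B x ^ 2) ((-2 * s) * (A x ^ 2 + B x ^ 2)) x := by
    intro x
    refine (((dA x).pow 2).sub ((dB x).pow 2)).congr_deriv ?_
    push_cast
    ring
  have h0 := integral_eq_zero_of_hasDerivAt_of_integrable hQ ((iA.add iB).const_mul _) (iA.sub iB)
  rw [integral_const_mul, mul_eq_zero, or_iff_right (by simpa using hs)] at h0
  replace h0 := (integral_eq_zero_iff_of_nonneg (f := fun x => A x ^ 2 + B x ^ 2)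
    (fun x => add_nonneg (sq_nonneg _) (sq_nonneg _)) (iA.add iB)).mp h0
  constructor
  · filter_upwards [h0, hc] with x hx hx'
    simp only [Pi.zero_apply] at hx
    rw [hx']; nlinarith [sq_nonneg (A x), sq_nonneg (B x)]
  · filter_upwards [h0, hd] with x hx hx'
    simp only [Pi.zero_apply] at hx
    rw [hx']; nlinarith [sq_nonneg (A x), sq_nonneg (B x)]

/-! ### Symmetry of the minimal operator -/

/-- Lagrange's identity. The term with `κ` cancels because `σ₂` is Hermitian and its coefficient
real; for differentiable `ψ`, `φ` what remains are the `x`-derivative of `⟨ψ, σ₃ φ⟩` and the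
`θ`-derivative of `⟨ψ, σ₁ φ⟩`. -/
theorem inner_diracExpr_sub_inner_diracExpr (w : ℝ → ℝ) (κ : ℝ) (ψ φ : ℝ × ℝ → Spinor)
    (p : ℝ × ℝ) :
    inner ℂ (diracExpr w κ ψ p) (φ p) - inner ℂ (ψ p) (diracExpr w κ φ p)
      = Complex.I * (inner ℂ (ψ p) (Matrix.toEuclideanCLM (𝕜 := ℂ) pauli3 (fderiv ℝ φ p (1, 0)))
          + inner ℂ (fderiv ℝ ψ p (1, 0)) (Matrix.toEuclideanCLM (𝕜 := ℂ) pauli3 (φ p)))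
        + Complex.I * ((w p.1 : ℂ) *
          (inner ℂ (ψ p) (Matrix.toEuclideanCLM (𝕜 := ℂ) pauli1 (fderiv ℝ φ p (0, 1)))
          + inner ℂ (fderiv ℝ ψ p (0, 1)) (Matrix.toEuclideanCLM (𝕜 := ℂ) pauli1 (φ p)))) := by
  simp only [diracExpr]
  generalize (κ / Real.sin p.2) = k
  generalize fderiv ℝ ψ p (1, 0) = a1
  generalize fderiv ℝ ψ p (0, 1) = a2
  generalize fderiv ℝ φ p (1, 0) = b1
  generalize fderiv ℝ φ p (0, 1) = b2
  simp [PiLp.inner_apply, Fin.sum_univ_two, Matrix.ofLp_toEuclideanCLM, pauli1, pauli2, pauli3,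
    Matrix.mulVec, dotProduct]
  ring

/-- The weight is merely continuous, but it is constant in the direction `(0, 1)`, so integration by
parts with line derivatives applies. -/
theorem integral_mul_fderiv_snd_eq_zero {w : ℝ → ℝ} (hw : Continuous w) {G : ℝ × ℝ → ℂ}
    (hG : ContDiff ℝ 1 G) (hc : HasCompactSupport G) :
    ∫ p : ℝ × ℝ, (w p.1 : ℂ) * fderiv ℝ G p (0, 1) = 0 := by
  have hG' : Continuous fun p => fderiv ℝ G p (0, 1) :=
    (hG.continuous_fderiv (by simp)).clm_apply continuous_const
  have hc' : HasCompactSupport fun p => fderiv ℝ G p (0, 1) :=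
    (hc.fderiv_apply ℝ (0, 1))
  have hwc : Continuous fun p : ℝ × ℝ => (w p.1 : ℂ) := by fun_prop
  have := integral_bilinear_hasLineDerivAt_right_eq_neg_left_of_integrable
    (μ := (volume : Measure (ℝ × ℝ))) (f := fun p : ℝ × ℝ => (w p.1 : ℂ)) (f' := fun _ => 0)
    (g := G) (g' := fun p => fderiv ℝ G p (0, 1)) (v := (0, 1))
    (B := ContinuousLinearMap.mul ℝ ℂ) (by simp)
    ((hwc.mul hG').integrable_of_hasCompactSupport hc'.mul_left)
    ((hwc.mul hG.continuous).integrable_of_hasCompactSupport hc.mul_left)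
    (fun p _ => by
      simp only [HasLineDerivAt]
      simpa using hasDerivAt_const (0 : ℝ) (w p.1 : ℂ))
    (fun p _ => ((hG.differentiable (by simp)) p).hasFDerivAt.hasLineDerivAt _)
  simpa using this

theorem integral_fderiv_eq_zero {G : ℝ × ℝ → ℂ} (hG : ContDiff ℝ 1 G) (hc : HasCompactSupport G)
    (v : ℝ × ℝ) : ∫ p : ℝ × ℝ, fderiv ℝ G p v = 0 := by
  have hG' : Continuous fun p => fderiv ℝ G p v :=
    (hG.continuous_fderiv (by simp)).clm_apply continuous_const
  have hc' : HasCompactSupport fun p => fderiv ℝ G p v := hc.fderiv_apply ℝ v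
  have := integral_mul_fderiv_eq_neg_fderiv_mul_of_integrable (𝕜 := ℂ)
    (μ := (volume : Measure (ℝ × ℝ))) (f := fun _ => 1) (g := G) (v := v) (by simp)
    (by simpa using hG'.integrable_of_hasCompactSupport hc')
    (by simpa using hG.continuous.integrable_of_hasCompactSupport hc)
    (fun _ _ => differentiableAt_const _) (fun p _ => (hG.differentiable (by simp)) p)
  simpa using this

theorem integrable_inner_of_memLp {α : Type*} [MeasurableSpace α] {μ : Measure α}
    {f g : α → Spinor} (hf : MemLp f 2 μ) (hg : MemLp g 2 μ) :
    Integrable (fun p => inner ℂ (f p) (g p)) μ := by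
  refine (L2.integrable_inner (𝕜 := ℂ) (hf.toLp f) (hg.toLp g)).congr ?_
  filter_upwards [hf.coeFn_toLp, hg.coeFn_toLp] with p h1 h2
  rw [h1, h2]

theorem integral_inner_diracExpr (w : ℝ → ℝ) (hw : Continuous w) (κ : ℝ) (ψ φ : 𝓓(Omega, Spinor)) :
    ∫ p in (Omega : Set (ℝ × ℝ)), inner ℂ (diracExpr w κ ψ p) (φ p)
      = ∫ p in (Omega : Set (ℝ × ℝ)), inner ℂ (ψ p) (diracExpr w κ φ p) := by
  have hi1 := integrable_inner_of_memLp (memLp_diracExpr hw κ ψ) (memLp_test φ)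
  have hi2 := integrable_inner_of_memLp (memLp_test ψ) (memLp_diracExpr hw κ φ)
  rw [← sub_eq_zero, ← integral_sub hi1 hi2]
  have hψ0 : ∀ p, p ∉ (Omega : Set (ℝ × ℝ)) → ψ p = 0 := fun p hp =>
    image_eq_zero_of_notMem_tsupport fun hq => hp (ψ.tsupport_subset hq)
  have hφ0 : ∀ p, p ∉ (Omega : Set (ℝ × ℝ)) → φ p = 0 := fun p hp =>
    image_eq_zero_of_notMem_tsupport fun hq => hp (φ.tsupport_subset hq)
  rw [setIntegral_eq_integral_of_forall_compl_eq_zero fun p hp => by rw [hψ0 p hp, hφ0 p hp]; simp]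
  simp only [inner_diracExpr_sub_inner_diracExpr]
  have hψd : ContDiff ℝ 1 ψ := ψ.contDiff.of_le (by simp)
  have hφd : ContDiff ℝ 1 φ := φ.contDiff.of_le (by simp)
  have hLφ : ∀ m : Matrix (Fin 2) (Fin 2) ℂ,
      ContDiff ℝ 1 fun p => Matrix.toEuclideanCLM (𝕜 := ℂ) m (φ p) := fun m =>
    ((Matrix.toEuclideanCLM (𝕜 := ℂ) m).restrictScalars ℝ).contDiff.comp hφd
  have hG : ∀ m : Matrix (Fin 2) (Fin 2) ℂ,
      ContDiff ℝ 1 fun p => inner ℂ (ψ p) (Matrix.toEuclideanCLM (𝕜 := ℂ) m (φ p)) := fun m =>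
    hψd.inner ℂ (hLφ m)
  have hGc : ∀ m : Matrix (Fin 2) (Fin 2) ℂ, HasCompactSupport
      fun p => inner ℂ (ψ p) (Matrix.toEuclideanCLM (𝕜 := ℂ) m (φ p)) := fun m =>
    ψ.hasCompactSupport.mono fun p hp => by
      rw [Function.mem_support] at hp ⊢
      rintro h0
      exact hp (by rw [h0, inner_zero_left])
  have hD : ∀ (m : Matrix (Fin 2) (Fin 2) ℂ) (p v : ℝ × ℝ),
      inner ℂ (ψ p) (Matrix.toEuclideanCLM (𝕜 := ℂ) m (fderiv ℝ φ p v))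
        + inner ℂ (fderiv ℝ ψ p v) (Matrix.toEuclideanCLM (𝕜 := ℂ) m (φ p))
      = fderiv ℝ (fun p => inner ℂ (ψ p) (Matrix.toEuclideanCLM (𝕜 := ℂ) m (φ p))) p v := by
    intro m p v
    rw [fderiv_inner_apply ℂ (hψd.differentiable (by simp) p) ((hLφ m).differentiable (by simp) p)]
    congr 2
    have := (((Matrix.toEuclideanCLM (𝕜 := ℂ) m).restrictScalars ℝ).hasFDerivAt.comp p
      (hφd.differentiable (by simp) p).hasFDerivAt).fderiv
    exact (congrArg (fun L => L v) this).symm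
  simp only [hD]
  have hcont : ∀ (m : Matrix (Fin 2) (Fin 2) ℂ) (v : ℝ × ℝ), Continuous fun p =>
      fderiv ℝ (fun p => inner ℂ (ψ p) (Matrix.toEuclideanCLM (𝕜 := ℂ) m (φ p))) p v := fun m v =>
    ((hG m).continuous_fderiv (by simp)).clm_apply continuous_const
  have hcs : ∀ (m : Matrix (Fin 2) (Fin 2) ℂ) (v : ℝ × ℝ), HasCompactSupport fun p =>
      fderiv ℝ (fun p => inner ℂ (ψ p) (Matrix.toEuclideanCLM (𝕜 := ℂ) m (φ p))) p v := fun m v =>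
    (hGc m).fderiv_apply ℝ v
  have hwc : Continuous fun p : ℝ × ℝ => (w p.1 : ℂ) := by fun_prop
  have i1 : Integrable fun p : ℝ × ℝ => (w p.1 : ℂ) * fderiv ℝ (fun p => inner ℂ (ψ p)
      (Matrix.toEuclideanCLM (𝕜 := ℂ) pauli1 (φ p))) p (0, 1) :=
    (hwc.mul (hcont _ _)).integrable_of_hasCompactSupport (hcs _ _).mul_left
  rw [integral_add
    (((hcont _ _).integrable_of_hasCompactSupport (hcs _ _)).const_mul _) (i1.const_mul _),
    integral_const_mul, integral_const_mul, integral_fderiv_eq_zero (hG _) (hGc _),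
    integral_mul_fderiv_snd_eq_zero hw (hG _) (hGc _)]
  simp

theorem minimalOperator_isFormalAdjoint (w : ℝ → ℝ) (hw : Continuous w) (κ : ℝ) :
    (minimalOperator w hw κ).IsFormalAdjoint (minimalOperator w hw κ) := by
  rintro ⟨_, ψ, rfl⟩ ⟨_, φ, rfl⟩
  have e1 := minimalOperator_apply w hw κ ψ
  have e2 := minimalOperator_apply w hw κ φ
  rw [e1, e2, L2.inner_def, L2.inner_def]
  have h1 : ∀ χ : 𝓓(Omega, Spinor), testToL2 χ =ᵐ[volume.restrict (Omega : Set (ℝ × ℝ))] χ :=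
    fun χ => (memLp_test χ).coeFn_toLp
  have h2 : ∀ χ : 𝓓(Omega, Spinor), diracOnTest w hw κ χ
      =ᵐ[volume.restrict (Omega : Set (ℝ × ℝ))] diracExpr w κ χ :=
    fun χ => (memLp_diracExpr hw κ χ).coeFn_toLp
  refine (integral_congr_ae ?_).trans
    ((integral_inner_diracExpr w hw κ ψ φ).trans (integral_congr_ae ?_))
  · filter_upwards [h1 φ, h2 ψ] with p hp hp'
    rw [hp, hp']
  · filter_upwards [h1 ψ, h2 φ] with p hp hp'
    rw [hp, hp']

/-! ### Test functions with one component -/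

/-- The test function whose component with index `j` is `g` and whose other component vanishes. -/
def singleTest (j : Fin 2) (g : ℝ × ℝ → ℝ) (hg : ContDiff ℝ (⊤ : ℕ∞) g) (hc : HasCompactSupport g)
    (hs : tsupport g ⊆ (Omega : Set (ℝ × ℝ))) : 𝓓(Omega, Spinor) where
  toFun p := g p • EuclideanSpace.single j (1 : ℂ)
  contDiff' := hg.smul contDiff_const
  hasCompactSupport' := hc.smul_right
  tsupport_subset' := (tsupport_smul_subset_left _ _).trans hs

/-- The sign of the eigenvalue of `σ₃` on the component with index `j`. -/
def chirality (j : Fin 2) : ℝ := if j = 0 then 1 else -1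

/-- `σ₃` preserves the component while `σ₁` and `σ₂` exchange `j` with `j.rev`. For real `g` both
coefficients are `-i` times a real number, which later lets real and imaginary parts separate. -/
theorem diracExpr_single (w : ℝ → ℝ) (κ : ℝ) (j : Fin 2) {g : ℝ × ℝ → ℝ} (hg : Differentiable ℝ g)
    (p : ℝ × ℝ) :
    diracExpr w κ (fun p => g p • EuclideanSpace.single j (1 : ℂ)) p
      = (-Complex.I * (chirality j * fderiv ℝ g p (1, 0) : ℝ)) • EuclideanSpace.single j (1 : ℂ)
        + (-Complex.I * (w p.1 * (fderiv ℝ g p (0, 1) + chirality j * κ / Real.sin p.2 * g p) : ℝ))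
          • EuclideanSpace.single j.rev (1 : ℂ) := by
  have hd : ∀ v, fderiv ℝ (fun p => g p • EuclideanSpace.single j (1 : ℂ)) p v
      = fderiv ℝ g p v • EuclideanSpace.single j (1 : ℂ) := by
    intro v
    rw [fderiv_smul_const (hg p)]
    rfl
  simp only [diracExpr, hd]
  ext i
  fin_cases j <;> fin_cases i <;>
  simp [Matrix.ofLp_toEuclideanCLM, pauli1, pauli2, pauli3, Matrix.mulVec, dotProduct,
    chirality] <;> ring

theorem inner_testToL2_singleTest (j : Fin 2) {g : ℝ × ℝ → ℝ} (hg : ContDiff ℝ (⊤ : ℕ∞) g)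
    (hc : HasCompactSupport g) (hs : tsupport g ⊆ (Omega : Set (ℝ × ℝ))) (v : L2Omega) :
    inner ℂ (testToL2 (singleTest j g hg hc hs)) v
      = ∫ p in (Omega : Set (ℝ × ℝ)), (g p : ℂ) * v p j := by
  rw [L2.inner_def]
  refine integral_congr_ae ?_
  filter_upwards [(memLp_test (singleTest j g hg hc hs)).coeFn_toLp] with p hp
  change inner ℂ ((memLp_test (singleTest j g hg hc hs)).toLp _ p) (v p) = _
  rw [hp]
  change inner ℂ (g p • EuclideanSpace.single j (1 : ℂ)) (v p) = _
  fin_cases j <;> simp [PiLp.inner_apply, mul_comm]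

theorem dense_domain_minimalOperator (w : ℝ → ℝ) (hw : Continuous w) (κ : ℝ) :
    Dense ((minimalOperator w hw κ).domain : Set L2Omega) := by
  change Dense (LinearMap.range testToL2 : Set L2Omega)
  rw [Submodule.dense_iff_topologicalClosure_eq_top, Submodule.topologicalClosure_eq_top_iff,
    Submodule.eq_bot_iff]
  intro v hv
  have hcomp : ∀ j : Fin 2, ∀ᵐ p, p ∈ (Omega : Set (ℝ × ℝ)) → v p j = 0 := by
    intro j
    have hvj : MemLp (fun p => v p j) 2 (volume.restrict (Omega : Set (ℝ × ℝ))) :=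
      (EuclideanSpace.proj (𝕜 := ℂ) j).comp_memLp' (Lp.memLp v)
    have hloc : LocallyIntegrableOn (fun p => v p j) (Omega : Set (ℝ × ℝ)) volume :=
      (locallyIntegrableOn_of_locallyIntegrable_restrict (hvj.locallyIntegrable (by norm_num)))
    refine Omega.isOpen.ae_eq_zero_of_integral_contDiff_smul_eq_zero hloc fun g hg hgc hgs => ?_
    have h1 := (Submodule.mem_orthogonal _ _).mp hv _ ⟨singleTest j g hg hgc hgs, rfl⟩
    rw [inner_testToL2_singleTest, setIntegral_eq_integral_of_forall_compl_eq_zero fun p hp => by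
      rw [image_eq_zero_of_notMem_tsupport fun hq => hp (hgs hq)]; simp] at h1
    simpa using h1
  rw [Lp.eq_zero_iff_ae_eq_zero]
  refine (ae_restrict_iff' Omega.isOpen.measurableSet).mpr ?_
  filter_upwards [hcomp 0, hcomp 1] with p h0 h1 hp
  ext i
  fin_cases i
  · exact h0 hp
  · exact h1 hp

/-! ### The weak form of the deficiency equation -/

/-- The pair `(u, v)` satisfies, in the weak sense on `Ω₂` and with real test functions, one of the
two scalar equations that make up the deficiency equation of the minimal operator. -/
def IsWeakSolution (w : ℝ → ℝ) (σ ν τ : ℝ) (u v : ℝ × ℝ → ℝ) : Prop :=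
  ∀ g : ℝ × ℝ → ℝ, ContDiff ℝ (⊤ : ℕ∞) g → HasCompactSupport g →
    tsupport g ⊆ (Omega : Set (ℝ × ℝ)) →
    ∫ p in (Omega : Set (ℝ × ℝ)), ((σ * fderiv ℝ g p (1, 0) - τ * g p) * u p
      + w p.1 * (fderiv ℝ g p (0, 1) + ν / Real.sin p.2 * g p) * v p) = 0

/-- After removal of a common factor `i` the equation has real coefficients, so any real-linear
functional may be applied to the components of `v`. It is used with the real and the imaginary part.
-/
theorem isWeakSolution_of_inner_eq_zero {w : ℝ → ℝ} (hw : Continuous w) {κ τ : ℝ} {v : L2Omega}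
    (h : ∀ ψ : 𝓓(Omega, Spinor),
      inner ℂ (diracOnTest w hw κ ψ + (τ * Complex.I) • testToL2 ψ) v = 0)
    (L : ℂ →L[ℝ] ℝ) (j : Fin 2) :
    IsWeakSolution w (chirality j) (chirality j * κ) τ (fun p => L (v p j))
      (fun p => L (v p j.rev)) := by
  intro g hg hc hs
  set ψ := singleTest j g hg hc hs with hψ
  have hae : (fun p => inner ℂ ((diracOnTest w hw κ ψ + (τ * Complex.I) • testToL2 ψ : L2Omega) p)
      (v p)) =ᵐ[volume.restrict (Omega : Set (ℝ × ℝ))]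
      fun p => Complex.I * ((chirality j * fderiv ℝ g p (1, 0) - τ * g p) • v p j
        + (w p.1 * (fderiv ℝ g p (0, 1) + chirality j * κ / Real.sin p.2 * g p)) • v p j.rev) := by
    filter_upwards [(memLp_diracExpr hw κ ψ).coeFn_toLp, (memLp_test ψ).coeFn_toLp,
      Lp.coeFn_add (diracOnTest w hw κ ψ) ((τ * Complex.I) • testToL2 ψ),
      Lp.coeFn_smul (τ * Complex.I) (testToL2 ψ)] with p h1 h2 h3 h4
    rw [h3, Pi.add_apply, h4, Pi.smul_apply]
    change inner ℂ ((memLp_diracExpr hw κ ψ).toLp _ p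
      + (τ * Complex.I) • (memLp_test ψ).toLp _ p) (v p) = _
    rw [h1, h2]
    have h5 := diracExpr_single w κ j (hg.differentiable (by simp)) p
    change diracExpr w κ ψ p = _ at h5
    have h6 : ψ p = g p • EuclideanSpace.single j (1 : ℂ) := rfl
    rw [h5, h6]
    generalize fderiv ℝ g p (1, 0) = a
    generalize w p.1 * (fderiv ℝ g p (0, 1) + chirality j * κ / Real.sin p.2 * g p) = b
    fin_cases j <;> simp [PiLp.inner_apply, Fin.sum_univ_two] <;> ring
  have hint := (L2.integrable_inner (𝕜 := ℂ)
    (diracOnTest w hw κ ψ + (τ * Complex.I) • testToL2 ψ) v).congr hae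
  have h0 := h ψ
  rw [L2.inner_def, integral_congr_ae hae, integral_const_mul, mul_eq_zero,
    or_iff_right Complex.I_ne_zero] at h0
  have hint' := (hint.const_mul (-Complex.I)).congr (Filter.Eventually.of_forall fun p => by
    simp only [← mul_assoc, neg_mul, Complex.I_mul_I, neg_neg, one_mul]
    rfl)
  have h7 := L.integral_comp_comm hint'
  refine (Eq.trans ?_ h7).trans ((congrArg L h0).trans (map_zero L))
  refine integral_congr_ae (Filter.Eventually.of_forall fun p => ?_)
  simp only [map_add, map_smul, smul_eq_mul]

/-! ### Test functions that do not vanish near the poles -/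

/-- Functions on a shrinking sequence of sets that are bounded in `L²` converge weakly to zero. -/
theorem tendsto_integral_mul_of_shrinking {α : Type*} [MeasurableSpace α] {μ : Measure α}
    {v : α → ℝ} (hv : MemLp v 2 μ) {b : ℕ → α → ℝ} {B : ℕ → Set α} {c : ℕ → ℝ} {D : ℝ}
    (hB : ∀ k, MeasurableSet (B k)) (hBf : ∀ k, μ (B k) ≠ ⊤)
    (hb : ∀ k, ∀ᵐ p ∂μ, p ∈ B k → b k p ^ 2 ≤ c k)
    (hb0 : ∀ k, ∀ᵐ p ∂μ, p ∉ B k → b k p = 0)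
    (hD : ∀ k, c k * μ.real (B k) ≤ D) (hev : ∀ᵐ p ∂μ, ∀ᶠ k in Filter.atTop, p ∉ B k) :
    Filter.Tendsto (fun k => ∫ p, b k p * v p ∂μ) Filter.atTop (nhds 0) := by
  have hv2 : Integrable (fun p => v p ^ 2) μ := hv.integrable_sq
  have hlim : Filter.Tendsto (fun k => ∫ p in B k, v p ^ 2 ∂μ) Filter.atTop (nhds 0) := by
    have h1 : Filter.Tendsto (fun k => ∫ p, (B k).indicator (fun p => v p ^ 2) p ∂μ) Filter.atTop
        (nhds (∫ _, (0 : ℝ) ∂μ)) := by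
      refine tendsto_integral_of_dominated_convergence (fun p => v p ^ 2)
        (fun k => hv2.aestronglyMeasurable.indicator (hB k)) hv2 (fun k => ?_) ?_
      · refine Filter.Eventually.of_forall fun p => ?_
        refine (norm_indicator_le_norm_self _ _).trans ?_
        rw [Real.norm_eq_abs, abs_of_nonneg (sq_nonneg _)]
      · filter_upwards [hev] with p hp
        refine tendsto_const_nhds.congr' ?_
        filter_upwards [hp] with k hk
        rw [indicator_of_notMem hk]
    simpa only [integral_zero, integral_indicator (hB _)] using h1
  -- Young's inequality with weight `δ`: the first term is small uniformly in `k`, the second tends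
  -- to zero for fixed `δ`.
  have hD0 : ∀ δ : ℝ, 0 < δ → ∀ k, |∫ p, b k p * v p ∂μ| ≤
      δ * D + δ⁻¹ * ∫ p in B k, v p ^ 2 ∂μ := by
    intro δ hδ k
    have i1 : Integrable ((B k).indicator fun _ => δ * c k) μ :=
      (integrable_indicator_iff (hB k)).mpr (integrableOn_const (hBf k))
    have i2 : Integrable ((B k).indicator fun p => δ⁻¹ * v p ^ 2) μ :=
      (hv2.const_mul _).indicator (hB k)
    have h1 : ‖∫ p, b k p * v p ∂μ‖ ≤ ∫ p, ((B k).indicator (fun _ => δ * c k) p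
        + (B k).indicator (fun p => δ⁻¹ * v p ^ 2) p) ∂μ := by
      refine norm_integral_le_of_norm_le (i1.add i2) ?_
      filter_upwards [hb k, hb0 k] with p h2 h3
      by_cases hp : p ∈ B k
      · rw [indicator_of_mem hp, indicator_of_mem hp, Real.norm_eq_abs]
        have h4 : |b k p * v p| ≤ δ * b k p ^ 2 + δ⁻¹ * v p ^ 2 := by
          rw [abs_mul, ← sq_abs (b k p), ← sq_abs (v p)]
          have h5 : 0 ≤ δ⁻¹ * (δ * |b k p| - |v p|) ^ 2 := by positivity
          have h6 : δ⁻¹ * (δ * |b k p| - |v p|) ^ 2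
              = δ * |b k p| ^ 2 + δ⁻¹ * |v p| ^ 2 - 2 * (|b k p| * |v p|) := by
            field_simp; ring
          have h7 : 0 ≤ |b k p| * |v p| := by positivity
          linarith
        exact h4.trans (by gcongr; exact h2 hp)
      · rw [h3 hp, indicator_of_notMem hp, indicator_of_notMem hp]; simp
    rw [integral_add i1 i2, integral_indicator (hB k), integral_indicator (hB k),
      setIntegral_const, smul_eq_mul, integral_const_mul, Real.norm_eq_abs] at h1
    have h8 := mul_le_mul_of_nonneg_left (hD k) hδ.le
    have h9 : μ.real (B k) * (δ * c k) = δ * (c k * μ.real (B k)) := by ring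
    linarith
  rw [Metric.tendsto_atTop]
  intro ε hε
  have hDp : 0 < |D| + 1 := by positivity
  set δ := ε / (2 * (|D| + 1)) with hδ
  have hδp : 0 < δ := by positivity
  obtain ⟨N, hN⟩ := (Metric.tendsto_atTop.mp hlim) (δ * (ε / 2)) (by positivity)
  refine ⟨N, fun k hk => ?_⟩
  rw [dist_zero_right, Real.norm_eq_abs]
  refine (hD0 δ hδp k).trans_lt ?_
  have h1 := hN k hk
  rw [dist_zero_right, Real.norm_eq_abs] at h1
  have h2 : δ⁻¹ * ∫ p in B k, v p ^ 2 ∂μ < ε / 2 := by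
    rw [inv_mul_lt_iff₀ hδp]
    exact (le_abs_self _).trans_lt h1
  have h3 : δ * D ≤ ε / 2 := by
    have : δ * D ≤ δ * (|D| + 1) := by gcongr; linarith [le_abs_self D]
    refine this.trans (le_of_eq ?_)
    rw [hδ]; field_simp
  linarith

/-- A smooth function on the line that vanishes near the endpoints of `(0, π)` and is equal to `1`
on most of that interval if `k` is large. -/
def poleCutoff (k θ : ℝ) : ℝ :=
  Real.smoothTransition (k * θ - 1) * Real.smoothTransition (k * (Real.pi - θ) - 1)

theorem contDiff_poleCutoff (k : ℝ) : ContDiff ℝ (⊤ : ℕ∞) (poleCutoff k) := by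
  unfold poleCutoff
  exact (Real.smoothTransition.contDiff.comp (by fun_prop)).mul
    (Real.smoothTransition.contDiff.comp (by fun_prop))

theorem poleCutoff_eq_zero_left {k θ : ℝ} (h : k * θ ≤ 1) : poleCutoff k θ = 0 := by
  rw [poleCutoff, Real.smoothTransition.zero_of_nonpos (by linarith), zero_mul]

theorem poleCutoff_eq_zero_right {k θ : ℝ} (h : k * (Real.pi - θ) ≤ 1) : poleCutoff k θ = 0 := by
  rw [poleCutoff, Real.smoothTransition.zero_of_nonpos (x := k * (Real.pi - θ) - 1) (by linarith),
    mul_zero]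

theorem poleCutoff_eq_one {k θ : ℝ} (h : 2 ≤ k * θ) (h' : 2 ≤ k * (Real.pi - θ)) :
    poleCutoff k θ = 1 := by
  rw [poleCutoff, Real.smoothTransition.one_of_one_le (by linarith),
    Real.smoothTransition.one_of_one_le (by linarith), one_mul]

theorem abs_poleCutoff_le (k θ : ℝ) : |poleCutoff k θ| ≤ 1 := by
  rw [poleCutoff, abs_mul, abs_of_nonneg (Real.smoothTransition.nonneg _),
    abs_of_nonneg (Real.smoothTransition.nonneg _)]
  exact mul_le_one₀ (Real.smoothTransition.le_one _) (Real.smoothTransition.nonneg _)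
    (Real.smoothTransition.le_one _)

theorem exists_abs_deriv_smoothTransition_le :
    ∃ C : ℝ, 0 < C ∧ ∀ t, |deriv Real.smoothTransition t| ≤ C := by
  have hc : Continuous (deriv Real.smoothTransition) :=
    (Real.smoothTransition.contDiff (n := 1)).continuous_deriv le_rfl
  have hs : HasCompactSupport (deriv Real.smoothTransition) := by
    refine HasCompactSupport.intro (isCompact_Icc (a := (0 : ℝ)) (b := 1)) fun t ht => ?_
    rcases lt_or_ge t 0 with h | h
    · have : Real.smoothTransition =ᶠ[nhds t] fun _ => 0 := by
        filter_upwards [Iio_mem_nhds h] with y hy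
        exact Real.smoothTransition.zero_of_nonpos (le_of_lt hy)
      rw [this.deriv_eq, deriv_const]
    · have h1 : 1 < t := by
        by_contra h0
        exact ht ⟨h, not_lt.mp h0⟩
      have : Real.smoothTransition =ᶠ[nhds t] fun _ => 1 := by
        filter_upwards [Ioi_mem_nhds h1] with y hy
        exact Real.smoothTransition.one_of_one_le (le_of_lt hy)
      rw [this.deriv_eq, deriv_const]
  obtain ⟨C, hC⟩ := hs.exists_bound_of_continuous hc
  exact ⟨max C 1, by positivity, fun t => (hC t).trans (le_max_left _ _)⟩

theorem exists_abs_deriv_poleCutoff_le :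
    ∃ C : ℝ, 0 < C ∧ ∀ k θ : ℝ, 0 ≤ k → |deriv (poleCutoff k) θ| ≤ C * k := by
  obtain ⟨C, hC, h⟩ := exists_abs_deriv_smoothTransition_le
  refine ⟨2 * C, by positivity, fun k θ hk => ?_⟩
  have hd : ∀ t, HasDerivAt Real.smoothTransition (deriv Real.smoothTransition t) t := fun t =>
    ((Real.smoothTransition.contDiff (n := 1)).differentiable (by simp) t).hasDerivAt
  have h1 : HasDerivAt (fun θ : ℝ => k * θ - 1) k θ := by
    simpa using ((hasDerivAt_id θ).const_mul k).sub_const 1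
  have h2 : HasDerivAt (fun θ : ℝ => k * (Real.pi - θ) - 1) (-k) θ := by
    simpa using (((hasDerivAt_id θ).const_sub Real.pi).const_mul k).sub_const 1
  have h3 := ((hd _).comp θ h1).mul ((hd _).comp θ h2)
  have h4 : deriv (poleCutoff k) θ = _ := h3.deriv
  rw [h4]
  refine (abs_add_le _ _).trans ?_
  simp only [Function.comp_apply, abs_mul, abs_neg, abs_of_nonneg hk,
    abs_of_nonneg (Real.smoothTransition.nonneg _)]
  have a1 := h (k * θ - 1)
  have a2 := h (k * (Real.pi - θ) - 1)
  have b1 := Real.smoothTransition.le_one (k * θ - 1)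
  have b2 := Real.smoothTransition.le_one (k * (Real.pi - θ) - 1)
  have b1' := Real.smoothTransition.nonneg (k * θ - 1)
  have b2' := Real.smoothTransition.nonneg (k * (Real.pi - θ) - 1)
  have e1 : |deriv Real.smoothTransition (k * θ - 1)| * k
      * Real.smoothTransition (k * (Real.pi - θ) - 1) ≤ C * k * 1 := by gcongr
  have e2 : Real.smoothTransition (k * θ - 1)
      * (|deriv Real.smoothTransition (k * (Real.pi - θ) - 1)| * k) ≤ 1 * (C * k) := by gcongr
  linarith

theorem deriv_poleCutoff_eq_zero {k θ : ℝ} (h : 2 < k * θ) (h' : 2 < k * (Real.pi - θ)) :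
    deriv (poleCutoff k) θ = 0 := by
  have c1 : Continuous fun θ : ℝ => k * θ := by fun_prop
  have c2 : Continuous fun θ : ℝ => k * (Real.pi - θ) := by fun_prop
  have : poleCutoff k =ᶠ[nhds θ] fun _ => 1 := by
    filter_upwards [(isOpen_lt continuous_const c1).mem_nhds h,
      (isOpen_lt continuous_const c2).mem_nhds h'] with y hy hy'
    exact poleCutoff_eq_one (le_of_lt hy) (le_of_lt hy')
  rw [this.deriv_eq, deriv_const]

/-- Outside `(0, π)` and near its endpoints the cutoff vanishes, so the behaviour of `E` there is
irrelevant. -/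
theorem contDiff_poleCutoff_mul {k : ℝ} (hk : 0 ≤ k) {E : ℝ → ℝ}
    (hE : ContDiffOn ℝ (⊤ : ℕ∞) E (Ioo 0 Real.pi)) :
    ContDiff ℝ (⊤ : ℕ∞) fun θ => poleCutoff k θ * E θ := by
  have c1 : Continuous fun θ : ℝ => k * θ := by fun_prop
  have c2 : Continuous fun θ : ℝ => k * (Real.pi - θ) := by fun_prop
  rw [contDiff_iff_contDiffAt]
  intro θ
  by_cases hθ : θ ∈ Ioo 0 Real.pi
  · exact (contDiff_poleCutoff k).contDiffAt.mul (hE.contDiffAt (isOpen_Ioo.mem_nhds hθ))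
  · refine (contDiffAt_const (c := (0 : ℝ))).congr_of_eventuallyEq ?_
    rcases le_or_gt θ 0 with h | h
    · have h1 : k * θ < 1 := by nlinarith
      filter_upwards [(isOpen_lt c1 continuous_const).mem_nhds h1] with y hy
      rw [poleCutoff_eq_zero_left (le_of_lt hy), zero_mul]
    · have h2 : Real.pi ≤ θ := by
        by_contra h0
        exact hθ ⟨h, not_le.mp h0⟩
      have h1 : k * (Real.pi - θ) < 1 := by nlinarith
      filter_upwards [(isOpen_lt c2 continuous_const).mem_nhds h1] with y hy
      rw [poleCutoff_eq_zero_right (le_of_lt hy), zero_mul]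

theorem memLp_fst_mul_snd {h e : ℝ → ℝ} (hh : Continuous h) (hc : HasCompactSupport h)
    (he : ContinuousOn e (Ioo 0 Real.pi)) {C : ℝ} (hC : ∀ θ ∈ Ioo 0 Real.pi, e θ ^ 2 ≤ C) :
    MemLp (fun p : ℝ × ℝ => h p.1 * e p.2) 2 (volume.restrict (Omega : Set (ℝ × ℝ))) := by
  obtain ⟨R, hR, hs⟩ := exists_pos_support_subset_Ioo hc
  obtain ⟨D, hD⟩ := hc.exists_bound_of_continuous hh
  have hm : MeasurableSet (Ioo (-R) R ×ˢ (univ : Set ℝ)) := measurableSet_Ioo.prod .univ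
  have hfin : (volume.restrict (Omega : Set (ℝ × ℝ))) (Ioo (-R) R ×ˢ (univ : Set ℝ)) ≠ ⊤ := by
    rw [Measure.restrict_apply hm]
    change volume (Ioo (-R) R ×ˢ univ ∩ univ ×ˢ Ioo 0 Real.pi) ≠ ⊤
    rw [prod_inter_prod, Measure.volume_eq_prod, Measure.prod_prod]
    simp [ENNReal.mul_eq_top]
  refine (memLp_indicator_const 2 hm (D * √C) (Or.inr hfin)).mono' ?_ ?_
  · refine ContinuousOn.aestronglyMeasurable ?_ Omega.isOpen.measurableSet
    exact (hh.comp continuous_fst).continuousOn.mul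
      (he.comp continuous_snd.continuousOn fun p hp => hp.2)
  · refine (ae_restrict_iff' Omega.isOpen.measurableSet).mpr (Filter.Eventually.of_forall ?_)
    intro p hp
    by_cases hx : p.1 ∈ Ioo (-R) R
    · rw [indicator_of_mem (show p ∈ Ioo (-R) R ×ˢ univ from ⟨hx, trivial⟩), norm_mul]
      exact mul_le_mul (hD _) (Real.abs_le_sqrt (hC _ hp.2)) (norm_nonneg _)
        ((norm_nonneg _).trans (hD p.1))
    · have h0 : h p.1 = 0 := by
        by_contra h1
        exact hx (hs h1)
      rw [indicator_of_notMem (fun h2 => hx h2.1), h0]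
      simp

theorem hasFDerivAt_fst_mul_snd {f h : ℝ → ℝ} (hf : Differentiable ℝ f) (hh : Differentiable ℝ h)
    (p : ℝ × ℝ) : HasFDerivAt (fun p : ℝ × ℝ => f p.1 * h p.2)
      (f p.1 • (deriv h p.2 • ContinuousLinearMap.snd ℝ ℝ ℝ)
        + h p.2 • (deriv f p.1 • ContinuousLinearMap.fst ℝ ℝ ℝ)) p :=
  ((hf p.1).hasDerivAt.comp_hasFDerivAt p hasFDerivAt_fst).mul
    ((hh p.2).hasDerivAt.comp_hasFDerivAt p hasFDerivAt_snd)

/-- The cutoff confines the support to `1 / k ≤ θ ≤ π - 1 / k` and makes the product a test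
function. `G` is the image of `E` under `∂_θ + ν / sin θ`; the price of the cutoff is the term with
its derivative. -/
theorem IsWeakSolution.integral_fst_mul_cutoff {w : ℝ → ℝ} {σ ν τ : ℝ} {u v : ℝ × ℝ → ℝ}
    (h : IsWeakSolution w σ ν τ u v) {f E G : ℝ → ℝ} (hf : ContDiff ℝ (⊤ : ℕ∞) f)
    (hfc : HasCompactSupport f) (hE : ContDiffOn ℝ (⊤ : ℕ∞) E (Ioo 0 Real.pi))
    (hEd : ∀ θ ∈ Ioo 0 Real.pi, HasDerivAt E (G θ - ν / Real.sin θ * E θ) θ) {k : ℝ}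
    (hk : 0 < k) :
    ∫ p in (Omega : Set (ℝ × ℝ)),
      (poleCutoff k p.2 * ((σ * deriv f p.1 - τ * f p.1) * E p.2 * u p
        + w p.1 * f p.1 * G p.2 * v p)
      + w p.1 * f p.1 * (deriv (poleCutoff k) p.2 * E p.2) * v p) = 0 := by
  have hhs := contDiff_poleCutoff_mul hk.le hE
  obtain ⟨R, hR, hs⟩ := exists_pos_support_subset_Ioo hfc
  have hsupp : Function.support (fun p : ℝ × ℝ => f p.1 * (poleCutoff k p.2 * E p.2)) ⊆
      Icc (-R) R ×ˢ Icc (1 / k) (Real.pi - 1 / k) := by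
    intro p hp
    have h1 : f p.1 ≠ 0 := left_ne_zero_of_mul hp
    have h2 : poleCutoff k p.2 ≠ 0 := left_ne_zero_of_mul (right_ne_zero_of_mul hp)
    refine ⟨Ioo_subset_Icc_self (hs h1), ?_, ?_⟩
    · by_contra h3
      refine h2 (poleCutoff_eq_zero_left ?_)
      have := (lt_div_iff₀ hk).mp (not_le.mp h3)
      linarith
    · by_contra h3
      refine h2 (poleCutoff_eq_zero_right ?_)
      have h4 : Real.pi - p.2 < 1 / k := by linarith [not_le.mp h3]
      have := (lt_div_iff₀ hk).mp h4
      linarith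
  have hcpt : IsCompact (Icc (-R) R ×ˢ Icc (1 / k) (Real.pi - 1 / k)) :=
    isCompact_Icc.prod isCompact_Icc
  have hts := closure_minimal hsupp hcpt.isClosed
  have hcs : HasCompactSupport fun p : ℝ × ℝ => f p.1 * (poleCutoff k p.2 * E p.2) :=
    hcpt.of_isClosed_subset isClosed_closure hts
  have hk1 : 0 < 1 / k := by positivity
  have h1 := h (fun p => f p.1 * (poleCutoff k p.2 * E p.2))
    ((hf.comp contDiff_fst).mul (hhs.comp contDiff_snd)) hcs (hts.trans fun p hp =>
      ⟨trivial, by linarith [hp.2.1], by linarith [hp.2.2]⟩)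
  rw [← h1]
  refine setIntegral_congr_fun Omega.isOpen.measurableSet fun p hp => ?_
  have hd : deriv (fun θ => poleCutoff k θ * E θ) p.2 = deriv (poleCutoff k) p.2 * E p.2
      + poleCutoff k p.2 * (G p.2 - ν / Real.sin p.2 * E p.2) :=
    (((contDiff_poleCutoff k).differentiable (by simp) p.2).hasDerivAt.mul (hEd p.2 hp.2)).deriv
  have hfd := (hasFDerivAt_fst_mul_snd (hf.differentiable (by simp))
    (hhs.differentiable (by simp)) p).fderiv
  simp only [hfd, hd]
  simp
  ring

theorem eventually_two_lt_mul {θ : ℝ} (hθ : θ ∈ Ioo 0 Real.pi) :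
    ∀ᶠ k : ℕ in Filter.atTop, 2 < ((k : ℝ) + 1) * θ ∧ 2 < ((k : ℝ) + 1) * (Real.pi - θ) := by
  have h1 : ∀ t : ℝ, 0 < t → ∀ᶠ k : ℕ in Filter.atTop, 2 < ((k : ℝ) + 1) * t := by
    intro t ht
    filter_upwards [Filter.eventually_ge_atTop ⌈2 / t⌉₊] with k hk
    have h2 := Nat.ceil_le.mp hk
    rw [div_le_iff₀ ht] at h2
    linarith
  exact (h1 θ hθ.1).and (h1 _ (by linarith [hθ.2]))

/-- In the weak equation the product of a test function on the line with a function on `(0, π)`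
that is `O(√(sin θ))` at the poles is admissible. -/
theorem IsWeakSolution.integral_fst_mul {w : ℝ → ℝ} (hw : Continuous w) {σ ν τ : ℝ}
    {u v : ℝ × ℝ → ℝ} (h : IsWeakSolution w σ ν τ u v)
    (hu : MemLp u 2 (volume.restrict (Omega : Set (ℝ × ℝ))))
    (hv : MemLp v 2 (volume.restrict (Omega : Set (ℝ × ℝ))))
    {f E G : ℝ → ℝ} (hf : ContDiff ℝ (⊤ : ℕ∞) f)
    (hfc : HasCompactSupport f) (hE : ContDiffOn ℝ (⊤ : ℕ∞) E (Ioo 0 Real.pi))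
    (hEd : ∀ θ ∈ Ioo 0 Real.pi, HasDerivAt E (G θ - ν / Real.sin θ * E θ) θ)
    (hEs : ∀ θ ∈ Ioo 0 Real.pi, E θ ^ 2 ≤ Real.sin θ)
    (hG : ContinuousOn G (Ioo 0 Real.pi)) {C : ℝ} (hGC : ∀ θ ∈ Ioo 0 Real.pi, G θ ^ 2 ≤ C) :
    ∫ p in (Omega : Set (ℝ × ℝ)), ((σ * deriv f p.1 - τ * f p.1) * E p.2 * u p
        + w p.1 * f p.1 * G p.2 * v p) = 0 := by
  set μ := volume.restrict (Omega : Set (ℝ × ℝ)) with hμ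
  set Ψ : ℝ × ℝ → ℝ := fun p => (σ * deriv f p.1 - τ * f p.1) * E p.2 * u p
        + w p.1 * f p.1 * G p.2 * v p with hΨ
  have hf' : Continuous (deriv f) := hf.continuous_deriv (by simp)
  have hE1 : ∀ θ ∈ Ioo 0 Real.pi, E θ ^ 2 ≤ 1 := fun θ hθ => (hEs θ hθ).trans (Real.sin_le_one θ)
  have cwf : Continuous fun x => w x * f x := hw.mul hf.continuous
  have swf : HasCompactSupport fun x => w x * f x := hfc.mul_left
  have i1 : Integrable (fun p => (σ * deriv f p.1 - τ * f p.1) * E p.2 * u p) μ :=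
    (memLp_fst_mul_snd (h := fun x => σ * deriv f x - τ * f x)
      ((continuous_const.mul hf').sub (continuous_const.mul hf.continuous))
      (hfc.deriv.mul_left.sub hfc.mul_left) hE.continuousOn hE1).integrable_mul hu
  have i2 : Integrable (fun p => w p.1 * f p.1 * G p.2 * v p) μ :=
    (memLp_fst_mul_snd (h := fun x => w x * f x) cwf swf hG hGC).integrable_mul hv
  have iΨ : Integrable Ψ μ := i1.add i2
  obtain ⟨D, hD⟩ := swf.exists_bound_of_continuous cwf
  obtain ⟨K, hK, hKη⟩ := exists_abs_deriv_poleCutoff_le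
  obtain ⟨R, hR, hs⟩ := exists_pos_support_subset_Ioo hfc
  -- The error caused by the cutoff. Within `Ω₂` it vanishes off the strips `B k` at the poles, of
  -- width `2 / (k + 1)` each; the parameter `k + 1` is positive also for `k = 0`.
  set b : ℕ → ℝ × ℝ → ℝ := fun k p =>
    w p.1 * f p.1 * (deriv (poleCutoff (k + 1)) p.2 * E p.2) with hb
  set B : ℕ → Set (ℝ × ℝ) := fun k =>
    Icc (-R) R ×ˢ (Iic (2 / ((k : ℝ) + 1)) ∪ Ici (Real.pi - 2 / ((k : ℝ) + 1))) with hBdef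
  have hkp : ∀ k : ℕ, 0 < (k : ℝ) + 1 := fun k => by positivity
  have hnB : ∀ (k : ℕ) (p : ℝ × ℝ), p ∉ B k → p.1 ∈ Icc (-R) R →
      2 < ((k : ℝ) + 1) * p.2 ∧ 2 < ((k : ℝ) + 1) * (Real.pi - p.2) := by
    intro k p hp hx
    have h1 : ¬(p.2 ≤ 2 / ((k : ℝ) + 1) ∨ Real.pi - 2 / ((k : ℝ) + 1) ≤ p.2) := fun h2 =>
      hp ⟨hx, h2⟩
    push Not at h1
    have h2 := (div_lt_iff₀ (hkp k)).mp h1.1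
    have h3 : 2 / ((k : ℝ) + 1) < Real.pi - p.2 := by linarith [h1.2]
    rw [div_lt_iff₀ (hkp k)] at h3
    constructor <;> linarith
  -- The squared cutoff derivative is `O((k + 1)²)`, but `E² ≤ sin θ ≤ 2 / (k + 1)` on the strips.
  -- The product grows only like `k + 1`, which the measure of the strips compensates.
  have hEB : ∀ (k : ℕ) (p : ℝ × ℝ), p ∈ B k → p ∈ (Omega : Set (ℝ × ℝ)) →
      (deriv (poleCutoff (k + 1)) p.2 * E p.2) ^ 2 ≤ 2 * K ^ 2 * (k + 1) := by
    intro k p hp hpΩ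
    have h1 : Real.sin p.2 ≤ 2 / ((k : ℝ) + 1) := by
      rcases hp.2 with h2 | h2
      · exact (Real.sin_le hpΩ.2.1.le).trans h2
      · rw [← Real.sin_pi_sub]
        have h3 : Real.pi - 2 / ((k : ℝ) + 1) ≤ p.2 := h2
        exact (Real.sin_le (by linarith [hpΩ.2.2])).trans (by linarith)
    rw [mul_pow, ← sq_abs (deriv _ _)]
    calc |deriv (poleCutoff (k + 1)) p.2| ^ 2 * E p.2 ^ 2
        ≤ (K * (k + 1)) ^ 2 * (2 / ((k : ℝ) + 1)) := by
          gcongr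
          · exact hKη _ _ (hkp k).le
          · exact (hEs _ hpΩ.2).trans h1
      _ = 2 * K ^ 2 * (k + 1) := by field_simp
  have hη0 : ∀ (k : ℕ) (θ : ℝ), 2 < ((k : ℝ) + 1) * θ ∧ 2 < ((k : ℝ) + 1) * (Real.pi - θ) →
      deriv (poleCutoff (k + 1)) θ = 0 := fun k θ hθ => deriv_poleCutoff_eq_zero hθ.1 hθ.2
  have hEall : ∀ (k : ℕ), ∀ θ ∈ Ioo 0 Real.pi,
      (deriv (poleCutoff (k + 1)) θ * E θ) ^ 2 ≤ 2 * K ^ 2 * (k + 1) := by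
    intro k θ hθ
    by_cases hp : ((0 : ℝ), θ) ∈ B k
    · exact hEB k (0, θ) hp ⟨trivial, hθ⟩
    · rw [hη0 k θ (hnB k (0, θ) hp ⟨by simp [hR.le], by simp [hR.le]⟩)]
      have := hkp k
      rw [zero_mul, zero_pow two_ne_zero]
      positivity
  have ib : ∀ k, Integrable (fun p => b k p * v p) μ := fun k =>
    (memLp_fst_mul_snd (h := fun x => w x * f x) cwf swf
      (e := fun θ => deriv (poleCutoff (k + 1)) θ * E θ)
      (((contDiff_poleCutoff _).continuous_deriv (by simp)).continuousOn.mul hE.continuousOn)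
      (hEall k)).integrable_mul hv
  have iη : ∀ k : ℕ, Integrable (fun p => poleCutoff (k + 1) p.2 * Ψ p) μ := fun k =>
    iΨ.bdd_mul (c := 1) ((contDiff_poleCutoff _).continuous.comp continuous_snd).aestronglyMeasurable
      (Filter.Eventually.of_forall fun p => abs_poleCutoff_le _ _)
  have hzero : ∀ k : ℕ, ∫ p, poleCutoff (k + 1) p.2 * Ψ p ∂μ = - ∫ p, b k p * v p ∂μ := by
    intro k
    have h1 := h.integral_fst_mul_cutoff hf hfc hE hEd (hkp k)
    rw [integral_add (iη k) (ib k)] at h1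
    linarith
  have hlim1 : Filter.Tendsto (fun k : ℕ => ∫ p, poleCutoff (k + 1) p.2 * Ψ p ∂μ) Filter.atTop
      (nhds (∫ p, Ψ p ∂μ)) := by
    refine tendsto_integral_of_dominated_convergence (fun p => ‖Ψ p‖)
      (fun k => (iη k).aestronglyMeasurable) iΨ.norm (fun k => Filter.Eventually.of_forall fun p => ?_)
      ((ae_restrict_iff' Omega.isOpen.measurableSet).mpr (Filter.Eventually.of_forall fun p hp => ?_))
    · rw [norm_mul]
      exact mul_le_of_le_one_left (norm_nonneg _) (abs_poleCutoff_le _ _)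
    · refine tendsto_const_nhds.congr' ?_
      filter_upwards [eventually_two_lt_mul hp.2] with k hk
      rw [poleCutoff_eq_one hk.1.le hk.2.le, one_mul]
  have hlim2 : Filter.Tendsto (fun k => ∫ p, b k p * v p ∂μ) Filter.atTop (nhds 0) := by
    have hBm : ∀ k, MeasurableSet (B k) := fun k =>
      measurableSet_Icc.prod (measurableSet_Iic.union measurableSet_Ici)
    have hsub : ∀ k, B k ∩ (Omega : Set (ℝ × ℝ)) ⊆ Icc (-R) R ×ˢ
        (Icc 0 (2 / ((k : ℝ) + 1)) ∪ Icc (Real.pi - 2 / ((k : ℝ) + 1)) Real.pi) := by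
      rintro k p ⟨hp, hpΩ⟩
      refine ⟨hp.1, ?_⟩
      rcases hp.2 with h2 | h2
      · exact Or.inl ⟨hpΩ.2.1.le, h2⟩
      · exact Or.inr ⟨h2, hpΩ.2.2.le⟩
    have hfin : ∀ k : ℕ, volume (Icc (-R) R ×ˢ (Icc 0 (2 / ((k : ℝ) + 1)) ∪
        Icc (Real.pi - 2 / ((k : ℝ) + 1)) Real.pi)) ≠ ⊤ := fun k =>
      (isCompact_Icc.prod (isCompact_Icc.union isCompact_Icc)).measure_lt_top.ne
    have hBr : ∀ k, μ (B k) = volume (B k ∩ (Omega : Set (ℝ × ℝ))) := fun k =>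
      Measure.restrict_apply (hBm k)
    -- The constant is `D² · 2K²(k + 1)` times the bound `2R · 4 / (k + 1)` for the measure of the
    -- strips.
    refine tendsto_integral_mul_of_shrinking hv (B := B)
      (c := fun k => D ^ 2 * (2 * K ^ 2 * (k + 1))) (D := 16 * R * D ^ 2 * K ^ 2) hBm
      (fun k => ?_) (fun k => ?_) (fun k => ?_) (fun k => ?_) ?_
    · rw [hBr]
      exact measure_ne_top_of_subset (hsub k) (hfin k)
    · refine (ae_restrict_iff' Omega.isOpen.measurableSet).mpr
        (Filter.Eventually.of_forall fun p hp hpB => ?_)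
      rw [hb, mul_pow, ← sq_abs (w p.1 * f p.1)]
      have h1 := hD p.1
      rw [Real.norm_eq_abs] at h1
      have h2 := hEB k p hpB hp
      gcongr
    · refine Filter.Eventually.of_forall fun p hp => ?_
      by_cases hx : p.1 ∈ Icc (-R) R
      · rw [hb]
        simp only [hη0 k _ (hnB k p hp hx), zero_mul, mul_zero]
      · have : f p.1 = 0 := by
          by_contra h0
          exact hx (Ioo_subset_Icc_self (hs h0))
        simp only [hb, this, mul_zero, zero_mul]
    · have h1 : μ.real (B k) ≤ 2 * R * (4 / ((k : ℝ) + 1)) := by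
        have h2 : μ.real (B k) ≤ volume.real (Icc (-R) R ×ˢ
            (Icc 0 (2 / ((k : ℝ) + 1)) ∪ Icc (Real.pi - 2 / ((k : ℝ) + 1)) Real.pi)) := by
          rw [Measure.real, hBr]
          exact ENNReal.toReal_mono (hfin k) (measure_mono (hsub k))
        refine h2.trans ?_
        rw [Measure.volume_eq_prod, measureReal_prod_prod]
        have hk2 : 0 < 2 / ((k : ℝ) + 1) := by have := hkp k; positivity
        have h3 := measureReal_union_le (μ := volume) (Icc 0 (2 / ((k : ℝ) + 1)))
          (Icc (Real.pi - 2 / ((k : ℝ) + 1)) Real.pi)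
        rw [Real.volume_real_Icc_of_le hk2.le, Real.volume_real_Icc_of_le (by linarith)] at h3
        rw [Real.volume_real_Icc_of_le (by linarith)]
        have h4 : 4 / ((k : ℝ) + 1) = 2 / ((k : ℝ) + 1) + 2 / ((k : ℝ) + 1) := by ring
        rw [h4]
        refine mul_le_mul (by linarith) (by linarith) measureReal_nonneg (by linarith)
      have h5 := hkp k
      calc D ^ 2 * (2 * K ^ 2 * (k + 1)) * μ.real (B k)
          ≤ D ^ 2 * (2 * K ^ 2 * (k + 1)) * (2 * R * (4 / ((k : ℝ) + 1))) := by gcongr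
        _ = 16 * R * D ^ 2 * K ^ 2 := by field_simp; ring
    · refine (ae_restrict_iff' Omega.isOpen.measurableSet).mpr
        (Filter.Eventually.of_forall fun p hp => ?_)
      filter_upwards [eventually_two_lt_mul hp.2] with k hk hpB
      have h5 := hkp k
      rcases hpB.2 with h2 | h2
      · have h3 := (le_div_iff₀ h5).mp h2
        linarith [hk.1]
      · have h3 : Real.pi - p.2 ≤ 2 / ((k : ℝ) + 1) := by
          have : Real.pi - 2 / ((k : ℝ) + 1) ≤ p.2 := h2
          linarith
        rw [le_div_iff₀ h5] at h3
        linarith [hk.2]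
  have h3 := hlim2.neg
  rw [neg_zero] at h3
  exact tendsto_nhds_unique hlim1 (h3.congr fun k => (hzero k).symm)

/-! ### Angular functions -/

/-- The angular function `sin (θ / 2) (sin θ)^ν (cos θ)ⁿ`. -/
def angularSin (ν : ℝ) (n : ℕ) (θ : ℝ) : ℝ :=
  Real.sin (θ / 2) * Real.sin θ ^ ν * Real.cos θ ^ n

/-- The angular function `cos (θ / 2) (sin θ)^ν (cos θ)ⁿ`. -/
def angularCos (ν : ℝ) (n : ℕ) (θ : ℝ) : ℝ :=
  Real.cos (θ / 2) * Real.sin θ ^ ν * Real.cos θ ^ n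

theorem sin_pos_of_mem {θ : ℝ} (hθ : θ ∈ Ioo 0 Real.pi) : 0 < Real.sin θ :=
  Real.sin_pos_of_pos_of_lt_pi hθ.1 hθ.2

theorem contDiffOn_sin_rpow (ν : ℝ) :
    ContDiffOn ℝ (⊤ : ℕ∞) (fun θ => Real.sin θ ^ ν) (Ioo 0 Real.pi) := fun _ hθ =>
  (Real.contDiff_sin.contDiffAt.rpow_const_of_ne (sin_pos_of_mem hθ).ne').contDiffWithinAt

theorem contDiffOn_angularSin (ν : ℝ) (n : ℕ) :
    ContDiffOn ℝ (⊤ : ℕ∞) (angularSin ν n) (Ioo 0 Real.pi) :=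
  ((Real.contDiff_sin.comp (contDiff_id.div_const 2)).contDiffOn.mul (contDiffOn_sin_rpow ν)).mul
    (Real.contDiff_cos.pow n).contDiffOn

theorem contDiffOn_angularCos (ν : ℝ) (n : ℕ) :
    ContDiffOn ℝ (⊤ : ℕ∞) (angularCos ν n) (Ioo 0 Real.pi) :=
  ((Real.contDiff_cos.comp (contDiff_id.div_const 2)).contDiffOn.mul (contDiffOn_sin_rpow ν)).mul
    (Real.contDiff_cos.pow n).contDiffOn

/-- The threshold `ν ≥ 1/2` is what is needed here: `(sin θ)^(2ν) ≤ sin θ` since `2ν ≥ 1` and `0 <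
sin θ ≤ 1`. -/
theorem sq_mul_sin_rpow_mul_cos_pow_le {ν : ℝ} (hν : 1 / 2 ≤ ν) (n : ℕ) {t θ : ℝ} (ht : t ^ 2 ≤ 1)
    (hθ : θ ∈ Ioo 0 Real.pi) : (t * Real.sin θ ^ ν * Real.cos θ ^ n) ^ 2 ≤ Real.sin θ := by
  have h0 := sin_pos_of_mem hθ
  have h1 : (Real.sin θ ^ ν) ^ 2 ≤ Real.sin θ := by
    rw [← Real.rpow_natCast, ← Real.rpow_mul h0.le]
    refine (Real.rpow_le_rpow_of_exponent_ge h0 (Real.sin_le_one θ) ?_).trans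
      (Real.rpow_one _).le
    push_cast
    linarith
  have h2 : (Real.cos θ ^ n) ^ 2 ≤ 1 := by
    rw [← pow_mul, mul_comm, pow_mul]
    exact pow_le_one₀ (sq_nonneg _) (Real.cos_sq_le_one θ)
  calc (t * Real.sin θ ^ ν * Real.cos θ ^ n) ^ 2
      = t ^ 2 * (Real.sin θ ^ ν) ^ 2 * (Real.cos θ ^ n) ^ 2 := by ring
    _ ≤ 1 * Real.sin θ * 1 := by gcongr
    _ = Real.sin θ := by ring

theorem angularSin_sq_le {ν : ℝ} (hν : 1 / 2 ≤ ν) (n : ℕ) {θ : ℝ} (hθ : θ ∈ Ioo 0 Real.pi) :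
    angularSin ν n θ ^ 2 ≤ Real.sin θ :=
  sq_mul_sin_rpow_mul_cos_pow_le hν n (Real.sin_sq_le_one _) hθ

theorem angularCos_sq_le {ν : ℝ} (hν : 1 / 2 ≤ ν) (n : ℕ) {θ : ℝ} (hθ : θ ∈ Ioo 0 Real.pi) :
    angularCos ν n θ ^ 2 ≤ Real.sin θ :=
  sq_mul_sin_rpow_mul_cos_pow_le hν n (Real.cos_sq_le_one _) hθ

theorem hasDerivAt_sin_rpow {ν θ : ℝ} (hθ : θ ∈ Ioo 0 Real.pi) :
    HasDerivAt (fun θ => Real.sin θ ^ ν) (ν * Real.cos θ / Real.sin θ * Real.sin θ ^ ν) θ := by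
  have h0 := sin_pos_of_mem hθ
  refine ((Real.hasDerivAt_sin θ).rpow_const (Or.inl h0.ne')).congr_deriv ?_
  rw [Real.rpow_sub_one h0.ne']
  field_simp

theorem hasDerivAt_cos_pow (n : ℕ) (θ : ℝ) :
    HasDerivAt (fun θ => Real.cos θ ^ n) (-(n * Real.cos θ ^ (n - 1) * Real.sin θ)) θ :=
  ((Real.hasDerivAt_cos θ).pow n).congr_deriv (by ring)

theorem half_angle {θ : ℝ} (hθ : θ ∈ Ioo 0 Real.pi) :
    0 < Real.sin (θ / 2) ∧ 0 < Real.cos (θ / 2) ∧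
      Real.sin θ = 2 * Real.sin (θ / 2) * Real.cos (θ / 2) ∧
      Real.cos θ = 2 * Real.cos (θ / 2) ^ 2 - 1 ∧
      Real.sin (θ / 2) ^ 2 = 1 - Real.cos (θ / 2) ^ 2 := by
  refine ⟨Real.sin_pos_of_pos_of_lt_pi (by linarith [hθ.1]) (by linarith [hθ.1, hθ.2]),
    Real.cos_pos_of_mem_Ioo ⟨by linarith [hθ.1, Real.pi_pos], by linarith [hθ.2]⟩, ?_, ?_, ?_⟩
  · rw [← Real.sin_two_mul]; ring_nf
  · rw [← Real.cos_two_mul]; ring_nf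
  · exact Real.sin_sq _

/-- The singular coefficient disappears because `sin (θ/2) (1 + cos θ) / sin θ = cos (θ/2)`.
Differentiating `(cos θ)ⁿ` gives both terms with the factor `n`, as `sin θ sin (θ/2) = (1 - cos θ)
cos (θ/2)`. At `n = 0` the truncated `n - 1` is harmless, since its coefficient is zero. -/
theorem hasDerivAt_angularSin (ν : ℝ) (n : ℕ) {θ : ℝ} (hθ : θ ∈ Ioo 0 Real.pi) :
    HasDerivAt (angularSin ν n) (((ν + 1 / 2 + n) * angularCos ν n θ
      - n * angularCos ν (n - 1) θ) - ν / Real.sin θ * angularSin ν n θ) θ := by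
  have h1 : HasDerivAt (fun θ : ℝ => Real.sin (θ / 2)) (Real.cos (θ / 2) * (1 / 2)) θ :=
    ((hasDerivAt_id θ).div_const 2).sin
  refine ((h1.mul (hasDerivAt_sin_rpow (ν := ν) hθ)).mul (hasDerivAt_cos_pow n θ)).congr_deriv ?_
  obtain ⟨hs, hc, e1, e2, e3⟩ := half_angle hθ
  simp only [angularSin, angularCos, Pi.mul_apply]
  generalize Real.sin θ ^ ν = T
  have e4 : (n : ℝ) * Real.cos θ ^ n = n * Real.cos θ ^ (n - 1) * Real.cos θ := by
    rcases n with _ | n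
    · simp
    · simp [pow_succ]; ring
  have e5 : (ν + 1 / 2 + n) * (Real.cos (θ / 2) * T * Real.cos θ ^ n)
      = (ν + 1 / 2) * (Real.cos (θ / 2) * T * Real.cos θ ^ n)
        + Real.cos (θ / 2) * T * (n * Real.cos θ ^ (n - 1) * Real.cos θ) := by rw [← e4]; ring
  rw [e5]
  generalize Real.cos θ ^ n = P
  generalize Real.cos θ ^ (n - 1) = P'
  rw [e1, e2]
  generalize Real.sin (θ / 2) = s at *
  generalize Real.cos (θ / 2) = c at *
  field_simp
  have e6 : s ^ 2 = 1 - c ^ 2 := e3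
  linear_combination (-4 * T * P' * (n : ℝ) * c ^ 2) * e6

/-- The companion with `-ν`: here `cos (θ/2) (1 - cos θ) / sin θ = sin (θ/2)` and `sin θ cos (θ/2) =
(1 + cos θ) sin (θ/2)`. -/
theorem hasDerivAt_angularCos (ν : ℝ) (n : ℕ) {θ : ℝ} (hθ : θ ∈ Ioo 0 Real.pi) :
    HasDerivAt (angularCos ν n) ((-(ν + 1 / 2 + n) * angularSin ν n θ
      - n * angularSin ν (n - 1) θ) - -ν / Real.sin θ * angularCos ν n θ) θ := by
  have h1 : HasDerivAt (fun θ : ℝ => Real.cos (θ / 2)) (-Real.sin (θ / 2) * (1 / 2)) θ :=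
    ((hasDerivAt_id θ).div_const 2).cos
  refine ((h1.mul (hasDerivAt_sin_rpow (ν := ν) hθ)).mul (hasDerivAt_cos_pow n θ)).congr_deriv ?_
  obtain ⟨hs, hc, e1, e2, e3⟩ := half_angle hθ
  simp only [angularSin, angularCos, Pi.mul_apply]
  generalize Real.sin θ ^ ν = T
  have e4 : (n : ℝ) * Real.cos θ ^ n = n * Real.cos θ ^ (n - 1) * Real.cos θ := by
    rcases n with _ | n
    · simp
    · simp [pow_succ]; ring
  have e5 : -(ν + 1 / 2 + n) * (Real.sin (θ / 2) * T * Real.cos θ ^ n)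
      = -(ν + 1 / 2) * (Real.sin (θ / 2) * T * Real.cos θ ^ n)
        - Real.sin (θ / 2) * T * (n * Real.cos θ ^ (n - 1) * Real.cos θ) := by rw [← e4]; ring
  rw [e5]
  generalize Real.cos θ ^ n = P
  generalize Real.cos θ ^ (n - 1) = P'
  rw [e1, e2]
  generalize Real.sin (θ / 2) = s at *
  generalize Real.cos (θ / 2) = c at *
  field_simp
  have e6 : s ^ 2 = 1 - c ^ 2 := e3
  linear_combination (2 * T * P * ν) * e6

/-- An integrable function on `(0, π)` all of whose moments with respect to `cos θ` vanish is
zero. -/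
theorem ae_eq_zero_of_integral_cos_pow_mul {h : ℝ → ℝ}
    (hh : Integrable h (volume.restrict (Ioo 0 Real.pi)))
    (h0 : ∀ n : ℕ, ∫ θ in Ioo 0 Real.pi, Real.cos θ ^ n * h θ = 0) :
    ∀ᵐ θ ∂(volume.restrict (Ioo 0 Real.pi)), h θ = 0 := by
  have hn : ∀ n : ℕ, Integrable (fun θ => Real.cos θ ^ n * h θ) (volume.restrict (Ioo 0 Real.pi)) :=
    fun n => hh.bdd_mul (c := 1) (Real.continuous_cos.pow n).aestronglyMeasurable
      (Filter.Eventually.of_forall fun θ => by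
        rw [norm_pow]
        exact pow_le_one₀ (norm_nonneg _) (Real.abs_cos_le_one θ))
  have hP : ∀ P : Polynomial ℝ,
      Integrable (fun θ => P.eval (Real.cos θ) * h θ) (volume.restrict (Ioo 0 Real.pi)) ∧
      ∫ θ in Ioo 0 Real.pi, P.eval (Real.cos θ) * h θ = 0 := by
    intro P
    induction P using Polynomial.induction_on' with
    | add p q hp hq =>
      simp only [Polynomial.eval_add, add_mul]
      refine ⟨hp.1.add hq.1, ?_⟩
      rw [integral_add hp.1 hq.1, hp.2, hq.2, add_zero]
    | monomial n c =>
      simp only [Polynomial.eval_monomial, mul_assoc]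
      refine ⟨(hn n).const_mul c, ?_⟩
      rw [integral_const_mul, h0, mul_zero]
  have key : ∀ g : ℝ → ℝ, Continuous g → ∫ θ in Ioo 0 Real.pi, g θ * h θ = 0 := by
    intro g hg
    obtain ⟨C, hC⟩ := isCompact_Icc.exists_bound_of_continuousOn (s := Icc 0 Real.pi) hg.continuousOn
    have hgi : Integrable (fun θ => g θ * h θ) (volume.restrict (Ioo 0 Real.pi)) :=
      hh.bdd_mul (c := C) hg.aestronglyMeasurable
        ((ae_restrict_iff' measurableSet_Ioo).mpr (Filter.Eventually.of_forall fun θ hθ =>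
          hC θ (Ioo_subset_Icc_self hθ)))
    have hle : ∀ ε : ℝ, 0 < ε → |∫ θ in Ioo 0 Real.pi, g θ * h θ|
        ≤ ε * ∫ θ in Ioo 0 Real.pi, ‖h θ‖ := by
      intro ε hε
      -- Weierstrass for `g ∘ arccos` on `[-1, 1]` approximates `g` on `(0, π)` by polynomials in
      -- `cos θ`.
      obtain ⟨P, hPε⟩ := exists_polynomial_near_of_continuousOn (-1) 1
        (fun t => g (Real.arccos t)) (hg.comp Real.continuous_arccos).continuousOn ε hε
      have h1 : ∫ θ in Ioo 0 Real.pi, g θ * h θ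
          = ∫ θ in Ioo 0 Real.pi, (g θ * h θ - P.eval (Real.cos θ) * h θ) := by
        rw [integral_sub hgi (hP P).1, (hP P).2, sub_zero]
      rw [h1, ← integral_const_mul, ← Real.norm_eq_abs]
      refine norm_integral_le_of_norm_le (hh.norm.const_mul ε) ?_
      refine (ae_restrict_iff' measurableSet_Ioo).mpr (Filter.Eventually.of_forall fun θ hθ => ?_)
      rw [← sub_mul, norm_mul]
      refine mul_le_mul_of_nonneg_right ?_ (norm_nonneg _)
      have h2 := hPε (Real.cos θ) ⟨Real.neg_one_le_cos θ, Real.cos_le_one θ⟩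
      rw [Real.arccos_cos hθ.1.le hθ.2.le] at h2
      rw [Real.norm_eq_abs, abs_sub_comm]
      exact h2.le
    have hI : 0 ≤ ∫ θ in Ioo 0 Real.pi, ‖h θ‖ := integral_nonneg fun _ => norm_nonneg _
    by_contra hne
    have hpos := abs_pos.mpr hne
    have h3 := hle (|∫ θ in Ioo 0 Real.pi, g θ * h θ| / (2 * ((∫ θ in Ioo 0 Real.pi, ‖h θ‖) + 1)))
      (by positivity)
    rw [div_mul_eq_mul_div, le_div_iff₀ (by positivity)] at h3
    nlinarith
  rw [ae_restrict_iff' measurableSet_Ioo]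
  refine isOpen_Ioo.ae_eq_zero_of_integral_contDiff_smul_eq_zero
    (IntegrableOn.locallyIntegrableOn hh) fun g hg _ hgs => ?_
  rw [← key g hg.continuous, setIntegral_eq_integral_of_forall_compl_eq_zero fun θ hθ => by
    rw [image_eq_zero_of_notMem_tsupport fun hq => hθ (hgs hq), zero_mul]]
  rfl

/-! ### Angular moments -/

/-- The integral of `e u(x, ·)` over `(0, π)`. -/
def angularMoment (e : ℝ → ℝ) (u : ℝ × ℝ → ℝ) (x : ℝ) : ℝ :=
  ∫ θ in Ioo 0 Real.pi, e θ * u (x, θ)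

theorem volume_restrict_Omega : volume.restrict (Omega : Set (ℝ × ℝ))
    = (volume : Measure ℝ).prod (volume.restrict (Ioo 0 Real.pi)) := by
  change (volume : Measure (ℝ × ℝ)).restrict (univ ×ˢ Ioo 0 Real.pi) = _
  rw [Measure.volume_eq_prod, ← Measure.prod_restrict, Measure.restrict_univ]

variable {u v : ℝ × ℝ → ℝ}

theorem integral_fst_mul_snd_mul (hu : MemLp u 2 (volume.restrict (Omega : Set (ℝ × ℝ))))
    {h e : ℝ → ℝ} (hh : Continuous h) (hc : HasCompactSupport h)
    (he : ContinuousOn e (Ioo 0 Real.pi)) {C : ℝ} (hC : ∀ θ ∈ Ioo 0 Real.pi, e θ ^ 2 ≤ C) :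
    Integrable (fun x => h x * angularMoment e u x) ∧
    ∫ p in (Omega : Set (ℝ × ℝ)), h p.1 * e p.2 * u p = ∫ x, h x * angularMoment e u x := by
  have hi : Integrable (fun p => h p.1 * e p.2 * u p) (volume.restrict (Omega : Set (ℝ × ℝ))) :=
    (memLp_fst_mul_snd hh hc he hC).integrable_mul hu
  rw [volume_restrict_Omega] at hi ⊢
  have e1 : (fun x => ∫ θ in Ioo 0 Real.pi, h x * e θ * u (x, θ))
      = fun x => h x * angularMoment e u x := by
    funext x
    simp only [mul_assoc, integral_const_mul, angularMoment]
  refine ⟨e1 ▸ hi.integral_prod_left, ?_⟩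
  rw [integral_prod _ hi]
  exact congrArg (fun F => ∫ x, F x) e1

theorem ae_memLp_fiber (hu : MemLp u 2 (volume.restrict (Omega : Set (ℝ × ℝ)))) :
    ∀ᵐ x : ℝ, MemLp (fun θ => u (x, θ)) 2 (volume.restrict (Ioo 0 Real.pi)) := by
  have h2 := hu.integrable_sq
  have hm := hu.aestronglyMeasurable
  rw [volume_restrict_Omega] at h2 hm
  filter_upwards [h2.prod_right_ae, hm.prodMk_left] with x h3 h4
  exact (memLp_two_iff_integrable_sq h4).mpr h3

theorem memLp_mul_of_sq_le {e φ : ℝ → ℝ} (he : ContinuousOn e (Ioo 0 Real.pi)) {C : ℝ}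
    (hC : ∀ θ ∈ Ioo 0 Real.pi, e θ ^ 2 ≤ C)
    (hφ : MemLp φ 2 (volume.restrict (Ioo 0 Real.pi))) :
    MemLp (fun θ => e θ * φ θ) 2 (volume.restrict (Ioo 0 Real.pi)) := by
  refine hφ.of_le_mul (c := √C)
    ((he.aestronglyMeasurable measurableSet_Ioo).mul hφ.aestronglyMeasurable) ?_
  refine (ae_restrict_iff' measurableSet_Ioo).mpr (Filter.Eventually.of_forall fun θ hθ => ?_)
  rw [norm_mul]
  exact mul_le_mul_of_nonneg_right (Real.abs_le_sqrt (hC θ hθ)) (norm_nonneg _)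

/-- Cauchy–Schwarz on an interval of length `π`, read off from the nonnegative variance `∫ (φ - m /
π)²`. -/
theorem sq_integral_le {φ : ℝ → ℝ} (hφ : MemLp φ 2 (volume.restrict (Ioo 0 Real.pi))) :
    (∫ θ in Ioo 0 Real.pi, φ θ) ^ 2 ≤ Real.pi * ∫ θ in Ioo 0 Real.pi, φ θ ^ 2 := by
  have h1 : Integrable φ (volume.restrict (Ioo 0 Real.pi)) := hφ.integrable (by norm_num)
  have h2 := hφ.integrable_sq
  set m := ∫ θ in Ioo 0 Real.pi, φ θ with hm
  have h3 : 0 ≤ ∫ θ in Ioo 0 Real.pi, (φ θ - m / Real.pi) ^ 2 := integral_nonneg fun _ => sq_nonneg _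
  have h4 : ∫ θ in Ioo 0 Real.pi, (φ θ - m / Real.pi) ^ 2
      = ∫ θ in Ioo 0 Real.pi, (φ θ ^ 2 - 2 * (m / Real.pi) * φ θ + (m / Real.pi) ^ 2) := by
    congr 1; funext θ; ring
  have h7 : Integrable (fun θ => φ θ ^ 2 - 2 * (m / Real.pi) * φ θ)
      (volume.restrict (Ioo 0 Real.pi)) := h2.sub (h1.const_mul _)
  rw [h4, integral_add h7 (integrable_const _), integral_sub h2 (h1.const_mul _), integral_const_mul, setIntegral_const, ← hm, smul_eq_mul,
    Real.volume_real_Ioo_of_le Real.pi_pos.le, sub_zero] at h3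
  have hpi := Real.pi_pos
  have h5 : Real.pi * (∫ θ in Ioo 0 Real.pi, φ θ ^ 2) - m ^ 2
      = Real.pi * ((∫ θ in Ioo 0 Real.pi, φ θ ^ 2) - 2 * (m / Real.pi) * m
        + Real.pi * (m / Real.pi) ^ 2) := by
    field_simp; ring
  have h6 := mul_nonneg hpi.le h3
  linarith

theorem memLp_angularMoment (hu : MemLp u 2 (volume.restrict (Omega : Set (ℝ × ℝ))))
    {e : ℝ → ℝ} (he : ContinuousOn e (Ioo 0 Real.pi)) (hC : ∀ θ ∈ Ioo 0 Real.pi, e θ ^ 2 ≤ 1) :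
    MemLp (angularMoment e u) 2 := by
  have hu2 := hu.integrable_sq
  have hum := hu.aestronglyMeasurable
  rw [volume_restrict_Omega] at hu2 hum
  have hem : AEStronglyMeasurable (fun p : ℝ × ℝ => e p.2 * u p)
      ((volume : Measure ℝ).prod (volume.restrict (Ioo 0 Real.pi))) :=
    ((he.aestronglyMeasurable measurableSet_Ioo).comp_snd).mul hum
  have hm : AEStronglyMeasurable (angularMoment e u) volume := hem.integral_prod_right'
  rw [memLp_two_iff_integrable_sq hm]
  refine (hu2.integral_prod_left.const_mul Real.pi).mono' (hm.pow 2) ?_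
  filter_upwards [ae_memLp_fiber hu] with x hx
  rw [Real.norm_eq_abs, abs_of_nonneg (sq_nonneg _)]
  have h1 := memLp_mul_of_sq_le he hC hx
  refine (sq_integral_le h1).trans (mul_le_mul_of_nonneg_left ?_ Real.pi_pos.le)
  refine setIntegral_mono_on h1.integrable_sq hx.integrable_sq measurableSet_Ioo fun θ hθ => ?_
  rw [mul_pow]
  exact mul_le_of_le_one_left (sq_nonneg _) (hC θ hθ)

/-- For almost every `x` the countably many conditions hold together, so `e u(x, ·)` has vanishing
cosine moments and is zero; then divide by `e`. -/
theorem ae_eq_zero_of_angularMoment {e : ℝ → ℝ}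
    (hu : MemLp u 2 (volume.restrict (Omega : Set (ℝ × ℝ))))
    (he : ContinuousOn e (Ioo 0 Real.pi)) (hC : ∀ θ ∈ Ioo 0 Real.pi, e θ ^ 2 ≤ 1)
    (hne : ∀ θ ∈ Ioo 0 Real.pi, e θ ≠ 0)
    (h : ∀ n : ℕ, ∀ᵐ x, angularMoment (fun θ => e θ * Real.cos θ ^ n) u x = 0) :
    ∀ᵐ p ∂(volume.restrict (Omega : Set (ℝ × ℝ))), u p = 0 := by
  have hfib : ∀ᵐ x : ℝ, ∫ θ in Ioo 0 Real.pi, u (x, θ) ^ 2 = 0 := by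
    filter_upwards [ae_memLp_fiber hu, ae_all_iff.mpr h] with x hx h0
    have h1 := (memLp_mul_of_sq_le he hC hx).integrable (by norm_num)
    have h2 := ae_eq_zero_of_integral_cos_pow_mul h1 fun n =>
      (integral_congr_ae (Filter.Eventually.of_forall fun θ => by ring)).trans (h0 n)
    rw [ae_restrict_iff' measurableSet_Ioo] at h2
    refine (setIntegral_congr_ae (g := fun _ => (0 : ℝ)) measurableSet_Ioo ?_).trans (by simp)
    filter_upwards [h2] with θ h3 hθ
    rw [(mul_eq_zero.mp (h3 hθ)).resolve_left (hne θ hθ), zero_pow two_ne_zero]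
  have hu2 := hu.integrable_sq
  have h4 : ∫ p in (Omega : Set (ℝ × ℝ)), u p ^ 2 = 0 := by
    rw [volume_restrict_Omega] at hu2 ⊢
    rw [integral_prod _ hu2, integral_congr_ae hfib, integral_zero]
  rw [integral_eq_zero_iff_of_nonneg (fun p => sq_nonneg _) hu2] at h4
  filter_upwards [h4] with p hp
  exact pow_eq_zero_iff two_ne_zero |>.mp hp

/-- The weak equation tested with a product and integrated over the angle. -/
theorem IsWeakSolution.integral_angularMoment {w : ℝ → ℝ} (hw : Continuous w) {σ ν τ : ℝ}
    (h : IsWeakSolution w σ ν τ u v)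
    (hu : MemLp u 2 (volume.restrict (Omega : Set (ℝ × ℝ))))
    (hv : MemLp v 2 (volume.restrict (Omega : Set (ℝ × ℝ))))
    {f E A A' : ℝ → ℝ} (hf : ContDiff ℝ (⊤ : ℕ∞) f) (hfc : HasCompactSupport f) {a b : ℝ}
    (hE : ContDiffOn ℝ (⊤ : ℕ∞) E (Ioo 0 Real.pi))
    (hEs : ∀ θ ∈ Ioo 0 Real.pi, E θ ^ 2 ≤ Real.sin θ)
    (hA : ContinuousOn A (Ioo 0 Real.pi)) (hA1 : ∀ θ ∈ Ioo 0 Real.pi, A θ ^ 2 ≤ 1)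
    (hA' : ContinuousOn A' (Ioo 0 Real.pi)) (hA1' : ∀ θ ∈ Ioo 0 Real.pi, A' θ ^ 2 ≤ 1)
    (hEd : ∀ θ ∈ Ioo 0 Real.pi, HasDerivAt E ((a * A θ - b * A' θ) - ν / Real.sin θ * E θ) θ)
    (hz : ∀ᵐ x, b * angularMoment A' v x = 0) :
    ∫ x, ((σ * deriv f x - τ * f x) * angularMoment E u x
      + w x * f x * (a * angularMoment A v x)) = 0 := by
  have hG : ContinuousOn (fun θ => a * A θ - b * A' θ) (Ioo 0 Real.pi) :=
    (continuousOn_const.mul hA).sub (continuousOn_const.mul hA')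
  have hGC : ∀ θ ∈ Ioo 0 Real.pi, (a * A θ - b * A' θ) ^ 2 ≤ 2 * a ^ 2 + 2 * b ^ 2 := by
    intro θ hθ
    have h1 := mul_le_mul_of_nonneg_left (hA1 θ hθ) (sq_nonneg a)
    have h2 := mul_le_mul_of_nonneg_left (hA1' θ hθ) (sq_nonneg b)
    nlinarith [sq_nonneg (a * A θ + b * A' θ)]
  have hE1 : ∀ θ ∈ Ioo 0 Real.pi, E θ ^ 2 ≤ 1 := fun θ hθ => (hEs θ hθ).trans (Real.sin_le_one θ)
  have h0 := h.integral_fst_mul hw hu hv hf hfc hE hEd hEs hG hGC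
  have hf' : Continuous (deriv f) := hf.continuous_deriv (by simp)
  have c1 : Continuous fun x => σ * deriv f x - τ * f x :=
    (continuous_const.mul hf').sub (continuous_const.mul hf.continuous)
  have s1 : HasCompactSupport fun x => σ * deriv f x - τ * f x :=
    hfc.deriv.mul_left.sub hfc.mul_left
  have c2 : Continuous fun x => w x * f x := hw.mul hf.continuous
  have s2 : HasCompactSupport fun x => w x * f x := hfc.mul_left
  have i1 := integral_fst_mul_snd_mul hu c1 s1 hE.continuousOn hE1
  have i2 := integral_fst_mul_snd_mul hv c2 s2 hG hGC
  have k1 : Integrable (fun p => (σ * deriv f p.1 - τ * f p.1) * E p.2 * u p)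
      (volume.restrict (Omega : Set (ℝ × ℝ))) :=
    (memLp_fst_mul_snd c1 s1 hE.continuousOn hE1).integrable_mul hu
  have k2 : Integrable (fun p => w p.1 * f p.1 * (a * A p.2 - b * A' p.2) * v p)
      (volume.restrict (Omega : Set (ℝ × ℝ))) := (memLp_fst_mul_snd c2 s2 hG hGC).integrable_mul hv
  rw [integral_add k1 k2, i1.2, i2.2,
    ← integral_add i1.1 i2.1] at h0
  rw [← h0]
  refine integral_congr_ae ?_
  -- `hz` removes the moment of lower index, so that only `A` couples to `E`.
  filter_upwards [hz, ae_memLp_fiber hv] with x hx hvx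
  have j1 := (memLp_mul_of_sq_le hA hA1 hvx).integrable (q := 2) (by norm_num)
  have j2 := (memLp_mul_of_sq_le hA' hA1' hvx).integrable (q := 2) (by norm_num)
  have e1 : angularMoment (fun θ => a * A θ - b * A' θ) v x
      = a * angularMoment A v x - b * angularMoment A' v x := by
    simp only [angularMoment]
    rw [← integral_const_mul, ← integral_const_mul,
      ← integral_sub (j1.const_mul a) (j2.const_mul b)]
    congr 1; funext θ; ring
  rw [e1, hx, sub_zero]

/-- The angular operator is triangular in `n`: once the moments of index `n - 1` vanish, those of
index `n` form a closed two-component system on the line. -/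
theorem angularMoment_eq_zero {w : ℝ → ℝ} (hw : Continuous w) {σ ν τ : ℝ} (hσ : σ ^ 2 = 1)
    (hν : 1 / 2 ≤ ν) (hτ : τ ≠ 0)
    (h1 : IsWeakSolution w σ ν τ u v) (h2 : IsWeakSolution w (-σ) (-ν) τ v u)
    (hu : MemLp u 2 (volume.restrict (Omega : Set (ℝ × ℝ))))
    (hv : MemLp v 2 (volume.restrict (Omega : Set (ℝ × ℝ)))) (n : ℕ) :
    (∀ᵐ x, angularMoment (angularSin ν n) u x = 0) ∧
      ∀ᵐ x, angularMoment (angularCos ν n) v x = 0 := by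
  have cS : ∀ m, ContinuousOn (angularSin ν m) (Ioo 0 Real.pi) := fun m =>
    (contDiffOn_angularSin ν m).continuousOn
  have cC : ∀ m, ContinuousOn (angularCos ν m) (Ioo 0 Real.pi) := fun m =>
    (contDiffOn_angularCos ν m).continuousOn
  have bS : ∀ m, ∀ θ ∈ Ioo 0 Real.pi, angularSin ν m θ ^ 2 ≤ 1 := fun m θ hθ =>
    (angularSin_sq_le hν m hθ).trans (Real.sin_le_one θ)
  have bC : ∀ m, ∀ θ ∈ Ioo 0 Real.pi, angularCos ν m θ ^ 2 ≤ 1 := fun m θ hθ =>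
    (angularCos_sq_le hν m hθ).trans (Real.sin_le_one θ)
  -- The factor `m` in the assumptions makes them void at `m = 0`, so one argument serves both the
  -- base case and the induction step.
  have step : ∀ m : ℕ, (∀ᵐ x, (m : ℝ) * angularMoment (angularCos ν (m - 1)) v x = 0) →
      (∀ᵐ x, (m : ℝ) * angularMoment (angularSin ν (m - 1)) u x = 0) →
      (∀ᵐ x, angularMoment (angularSin ν m) u x = 0) ∧
        ∀ᵐ x, angularMoment (angularCos ν m) v x = 0 := by
    intro m hz1 hz2
    have hσ0 : σ ≠ 0 := by
      rintro rfl
      norm_num at hσ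
    -- Multiplying the two equations by `σ` and `-σ`, with `σ² = 1`, brings them to the normal form
    -- with these `ω` and `s`.
    refine ae_eq_zero_of_weak_system (ω := fun x => σ * (ν + 1 / 2 + m) * w x) (s := σ * τ)
      (continuous_const.mul hw) (mul_ne_zero hσ0 hτ) (memLp_angularMoment hu (cS m) (bS m))
      (memLp_angularMoment hv (cC m) (bC m)) (fun f hf hfc => ?_) (fun f hf hfc => ?_)
    · have h3 := h1.integral_angularMoment hw hu hv hf hfc (contDiffOn_angularSin ν m)
        (fun θ hθ => angularSin_sq_le hν m hθ) (cC m) (bC m) (cC (m - 1)) (bC (m - 1))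
        (fun θ hθ => hasDerivAt_angularSin ν m hθ) hz1
      rw [← mul_zero σ, ← h3, ← integral_const_mul]
      congr 1; funext x
      linear_combination (-deriv f x * angularMoment (angularSin ν m) u x) * hσ
    · have h3 := h2.integral_angularMoment hw hv hu hf hfc (contDiffOn_angularCos ν m)
        (fun θ hθ => angularCos_sq_le hν m hθ) (cS m) (bS m) (cS (m - 1)) (bS (m - 1))
        (fun θ hθ => hasDerivAt_angularCos ν m hθ) hz2
      rw [← mul_zero (-σ), ← h3, ← integral_const_mul]
      congr 1; funext x
      linear_combination (-deriv f x * angularMoment (angularCos ν m) v x) * hσ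
  induction n with
  | zero => exact step 0 (by simp) (by simp)
  | succ n ih =>
    refine step (n + 1) ?_ ?_
    · filter_upwards [ih.2] with x hx
      rw [Nat.add_sub_cancel, hx, mul_zero]
    · filter_upwards [ih.1] with x hx
      rw [Nat.add_sub_cancel, hx, mul_zero]

theorem IsWeakSolution.ae_eq_zero {w : ℝ → ℝ} (hw : Continuous w) {σ ν τ : ℝ} (hσ : σ ^ 2 = 1)
    (hν : 1 / 2 ≤ ν) (hτ : τ ≠ 0)
    (h1 : IsWeakSolution w σ ν τ u v) (h2 : IsWeakSolution w (-σ) (-ν) τ v u)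
    (hu : MemLp u 2 (volume.restrict (Omega : Set (ℝ × ℝ))))
    (hv : MemLp v 2 (volume.restrict (Omega : Set (ℝ × ℝ)))) :
    (∀ᵐ p ∂(volume.restrict (Omega : Set (ℝ × ℝ))), u p = 0) ∧
      ∀ᵐ p ∂(volume.restrict (Omega : Set (ℝ × ℝ))), v p = 0 := by
  have hm := angularMoment_eq_zero hw hσ hν hτ h1 h2 hu hv
  constructor
  · refine ae_eq_zero_of_angularMoment (e := angularSin ν 0) hu
      (contDiffOn_angularSin ν 0).continuousOn
      (fun θ hθ => (angularSin_sq_le hν 0 hθ).trans (Real.sin_le_one θ)) (fun θ hθ => ?_)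
      fun n => ?_
    · have h3 := sin_pos_of_mem hθ
      have h4 := (half_angle hθ).1
      rw [angularSin]
      positivity
    · have e1 : (fun θ => angularSin ν 0 θ * Real.cos θ ^ n) = angularSin ν n := by
        funext θ
        simp [angularSin]
      rw [e1]
      exact (hm n).1
  · refine ae_eq_zero_of_angularMoment (e := angularCos ν 0) hv
      (contDiffOn_angularCos ν 0).continuousOn
      (fun θ hθ => (angularCos_sq_le hν 0 hθ).trans (Real.sin_le_one θ)) (fun θ hθ => ?_)
      fun n => ?_
    · have h3 := sin_pos_of_mem hθ
      have h4 := (half_angle hθ).2.1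
      rw [angularCos]
      positivity
    · have e1 : (fun θ => angularCos ν 0 θ * Real.cos θ ^ n) = angularCos ν n := by
        funext θ
        simp [angularCos]
      rw [e1]
      exact (hm n).2

/-! ### Essential selfadjointness -/

theorem chirality_rev (j : Fin 2) : chirality j.rev = -chirality j := by
  fin_cases j <;> simp [chirality]

theorem chirality_sq (j : Fin 2) : chirality j ^ 2 = 1 := by
  fin_cases j <;> simp [chirality]

theorem eq_zero_of_inner_eq_zero {w : ℝ → ℝ} (hw : Continuous w) {κ τ : ℝ} (hκ : 1 / 2 ≤ |κ|)
    (hτ : τ ≠ 0) {v : L2Omega}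
    (h : ∀ ψ : 𝓓(Omega, Spinor),
      inner ℂ (diracOnTest w hw κ ψ + (τ * Complex.I) • testToL2 ψ) v = 0) : v = 0 := by
  -- Exchanging the components reverses the sign of `κ`, so the component taken as `u` can be chosen
  -- with `ν = |κ|`.
  obtain ⟨j, hj⟩ : ∃ j : Fin 2, 1 / 2 ≤ chirality j * κ := by
    rcases le_total 0 κ with h0 | h0
    · exact ⟨0, by rw [abs_of_nonneg h0] at hκ; simpa [chirality] using hκ⟩
    · exact ⟨1, by rw [abs_of_nonpos h0] at hκ; simpa [chirality] using hκ⟩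
  have hL : ∀ L : ℂ →L[ℝ] ℝ,
      (∀ᵐ p ∂(volume.restrict (Omega : Set (ℝ × ℝ))), L (v p j) = 0) ∧
      ∀ᵐ p ∂(volume.restrict (Omega : Set (ℝ × ℝ))), L (v p j.rev) = 0 := by
    intro L
    have hm : ∀ i : Fin 2, MemLp (fun p => L (v p i)) 2 (volume.restrict (Omega : Set (ℝ × ℝ))) :=
      fun i => L.comp_memLp' ((EuclideanSpace.proj (𝕜 := ℂ) i).comp_memLp' (Lp.memLp v))
    have h2 := isWeakSolution_of_inner_eq_zero hw h L j.rev
    rw [Fin.rev_rev, chirality_rev, neg_mul] at h2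
    exact IsWeakSolution.ae_eq_zero hw (chirality_sq j) hj hτ
      (isWeakSolution_of_inner_eq_zero hw h L j) h2 (hm _) (hm _)
  have hre := hL Complex.reCLM
  have him := hL Complex.imCLM
  rw [Lp.eq_zero_iff_ae_eq_zero]
  filter_upwards [hre.1, hre.2, him.1, him.2] with p h1 h2 h3 h4
  have h5 : v p j = 0 := Complex.ext h1 h3
  have h6 : v p j.rev = 0 := Complex.ext h2 h4
  ext i
  rcases eq_or_ne i j with rfl | hij
  · exact h5
  · have : i = j.rev := by
      clear h1 h2 h3 h4 h5 h6 hre him hL h hj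
      fin_cases i <;> fin_cases j <;> simp_all
    rw [this]
    exact h6

/-- The minimal operator is essentially selfadjoint for every continuous weight as soon as
`|κ| ≥ 1/2`. -/
theorem isEssentiallySelfAdjoint_minimalOperator {w : ℝ → ℝ} (hw : Continuous w) {κ : ℝ}
    (hκ : 1 / 2 ≤ |κ|) : IsEssentiallySelfAdjoint (minimalOperator w hw κ) := by
  refine .of_orthogonal_range (dense_domain_minimalOperator w hw κ)
    (minimalOperator_isFormalAdjoint w hw κ) (fun v h => ?_) fun v h => ?_
  · refine eq_zero_of_inner_eq_zero hw hκ (one_ne_zero (α := ℝ)) fun ψ => ?_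
    rw [← h ⟨testToL2 ψ, LinearMap.mem_range_self _ ψ⟩, minimalOperator_apply, Complex.ofReal_one, one_mul]
  · refine eq_zero_of_inner_eq_zero hw hκ (neg_ne_zero.mpr (one_ne_zero (α := ℝ))) fun ψ => ?_
    rw [← h ⟨testToL2 ψ, LinearMap.mem_range_self _ ψ⟩, minimalOperator_apply, Complex.ofReal_neg, Complex.ofReal_one, neg_one_mul,
      neg_smul, sub_eq_add_neg]

theorem half_le_abs_of_half_integer {κ : ℝ} (hκ : ∃ k : ℤ, κ = (k : ℝ) + 1 / 2) :
    1 / 2 ≤ |κ| := by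
  obtain ⟨k, rfl⟩ := hκ
  rcases le_or_gt 0 k with hk | hk
  · have : (0 : ℝ) ≤ k := by exact_mod_cast hk
    exact le_abs.mpr (Or.inl (by linarith))
  · have : (k : ℝ) ≤ -1 := by exact_mod_cast (show k ≤ -1 by omega)
    exact le_abs.mpr (Or.inr (by linarith))

end KerrNewman

end

theorem mainTheorem6 (M Q a rp : ℝ) (hM : 0 < M)
    (hrp : IsGreatest {ρ : ℝ | KerrNewman.Delta M Q a ρ = 0} rp)
    (x r : ℝ → ℝ) (hxr : KerrNewman.IsRadialCoordinate M Q a rp x r)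
    (κ : ℝ) (hκ : ∃ k : ℤ, κ = (k : ℝ) + 1 / 2) :
    KerrNewman.IsEssentiallySelfAdjoint
      (KerrNewman.minimalOperator (KerrNewman.weight M Q a r)
        (hxr.continuous_weight hM hrp) κ) :=
  KerrNewman.isEssentiallySelfAdjoint_minimalOperator _
    (KerrNewman.half_le_abs_of_half_integer hκ)
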